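/- Let $\Lambda=(1,0)\mathbb Z+(\tfrac12,\tfrac{\sqrt3}{2})\mathbb Z\subset\mathbb R^2$ be the triangular lattice and let $K$ be the tessellation of $\mathbb R^2$ by the equilateral triangles of side length $1$ with vertices in $\Lambda$. The honeycomb graph $G$ has as vertex set $V$ the set of barycenters of the triangles of $K$, and two distinct vertices are adjacent when their triangles share a side. The triangle with barycenter $x\in V$ is called the dual cell of $x$. Let $A(x,y)=g(x,y)=1$ if $x,y\in V$ are adjacent and $A(x,y)=g(x,y)=0$ otherwise. For a finite set $X\subset V$ let $\overrightarrow{\partial X}=\{(x,y):\ x\in X,\ y\in V\setminus X,\ A(x,y)\neq0\}$. For $x\in V$ put $\mathcal V_x=\{A(x,y)^2(y-x):\ y\in V,\ A(x,y)\ne0\}$ and $$C_{\mathcal V_x}=\max\Big\{\Big|\bigcap_{v\in\mathcal V_x}\{p\in\mathbb R^2:\ \langle p,v\rangle\le c_v\}\Big|:\ (c_v)\in\mathbb R^{\mathcal V_x},\ \sum_{v\in\mathcal V_x}c_v=1\Big\},$$ where $|\cdot|$ denotes area, and put $$H=\{p\in\mathbb R^2:\ A(x,y)\langle y-x,p\rangle\le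 g(x,y)\ \text{ for all } x,y\in V \text{ with } A(x,y)\neq0\}.$$ Then the following hold. 1. For every $x\in V$ the maximum defining $C_{\mathcal V_x}$ is attained, $C_{\mathcal V_x}=\sqrt3$, and every maximizing intersection of half-planes is an equilateral triangle of side length $2$. 2. $H$ is a regular hexagon of side length $2$, and its area is $|H|=6\sqrt3$. 3. For every finite $X\subset V$ one has $6\,\sharp X\le(\sharp\overrightarrow{\partial X})^2$. 4. For every nonempty finite $X\subset V$, the following are equivalent: (a) $6\,\sharp X=(\sharp\overrightarrow{\partial X})^2$; (b) the dual cells of the points of $X$ tessellate a translate of $rH$ for some $r>0$; (c) $\sharp X=6k^2$ for some integer $k\ge1$ and the dual cells of the points of $X$ tessellate a regular hexagon. 5. The inequality is sharp: for every integer $k\ge1$ there is $X\subset V$ with $\sharp X=6k^2$ and $6\,\sharp X=(\sharp\overrightarrow{\partial X})^2$. -/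

import Mathlib

open MeasureTheory

/-! ### Weighted graphs in Euclidean space -/

section Weighted

variable {d : ℕ} {V : Set (EuclideanSpace ℝ (Fin d))}

/-- The vectors `𝒱ₓ = {A(x,y)² (y - x) : A(x,y) ≠ 0}` attached to a vertex `x` of the graph on
`V ⊆ ℝᵈ` whose edges are the pairs of non-zero weight `A`. -/
def neighborVectors (A : V → V → ℝ) (x : V) : Set (EuclideanSpace ℝ (Fin d)) :=
  {v | ∃ y : V, A x y ≠ 0 ∧
    v = (A x y) ^ 2 • ((y : EuclideanSpace ℝ (Fin d)) - (x : EuclideanSpace ℝ (Fin d)))}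

/-- The intersection of half-spaces `⋂_{v ∈ 𝒱} {p : ⟨p, v⟩ ≤ c_v}`. -/
def halfspaceIntersection (𝒱 : Set (EuclideanSpace ℝ (Fin d)))
    (c : EuclideanSpace ℝ (Fin d) → ℝ) : Set (EuclideanSpace ℝ (Fin d)) :=
  {p | ∀ v ∈ 𝒱, inner ℝ p v ≤ c v}

/-- `IsOptimalConstant 𝒱 C` says that the maximum
`C_𝒱 = max {|⋂_{v ∈ 𝒱} {p : ⟨p, v⟩ ≤ c_v}| : ∑_{v ∈ 𝒱} c_v = 1}` (for a finite set `𝒱`)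
is attained and equals `C`. Only the values of `c` on `𝒱` matter. -/
def IsOptimalConstant (𝒱 : Set (EuclideanSpace ℝ (Fin d))) (C : ENNReal) : Prop :=
  IsGreatest {a : ENNReal | ∃ c : EuclideanSpace ℝ (Fin d) → ℝ,
    ∑ᶠ v ∈ 𝒱, c v = 1 ∧ a = volume (halfspaceIntersection 𝒱 c)} C

/-- The region `H = {p : A(x,y) ⟨y - x, p⟩ ≤ g(x,y) for all x, y with A(x,y) ≠ 0}`. -/
def wulffRegion (A g : V → V → ℝ) : Set (EuclideanSpace ℝ (Fin d)) :=
  {p | ∀ x y : V, A x y ≠ 0 →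
    A x y * inner ℝ ((y : EuclideanSpace ℝ (Fin d)) - (x : EuclideanSpace ℝ (Fin d))) p ≤ g x y}

/-- The oriented edge boundary of `X`: all `(x, y)` with `x ∈ X`, `y ∉ X`, `A(x,y) ≠ 0`. -/
def orientedBoundary (A : V → V → ℝ) (X : Finset V) : Set (V × V) :=
  {e | e.1 ∈ X ∧ e.2 ∉ X ∧ A e.1 e.2 ≠ 0}

end Weighted

/-! ### Regular polygons in the plane -/

/-- The Euclidean plane. -/
abbrev Plane : Type := EuclideanSpace ℝ (Fin 2)

/-- `S` is a (solid) regular `n`-gon of side length `s`: the convex hull of `n` equally spaced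
points on a circle of radius `R > 0`, where `s = 2 R sin (π / n)`. -/
def IsRegularPolygon (n : ℕ) (s : ℝ) (S : Set Plane) : Prop :=
  ∃ (o : Plane) (R θ : ℝ), 0 < R ∧ s = 2 * R * Real.sin (Real.pi / n) ∧
    S = convexHull ℝ (Set.range fun j : Fin n =>
      o + R • (!₂[Real.cos (θ + 2 * Real.pi * (j : ℝ) / n),
        Real.sin (θ + 2 * Real.pi * (j : ℝ) / n)] : Plane))

/-! ### The triangular tessellation and the honeycomb graph -/

/-- The triangular lattice `(1, 0) ℤ + (1/2, √3/2) ℤ`. -/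
def triangularLattice : Set Plane :=
  {x | ∃ m n : ℤ, x = (m : ℝ) • (!₂[1, 0] : Plane) + (n : ℝ) • (!₂[1 / 2, √3 / 2] : Plane)}

/-- `a, b, c` are the vertices of a tile of the tessellation `K`, that is, of an equilateral
triangle of side length `1` with vertices in the triangular lattice. -/
def IsTile (a b c : Plane) : Prop :=
  a ∈ triangularLattice ∧ b ∈ triangularLattice ∧ c ∈ triangularLattice ∧
    dist a b = 1 ∧ dist b c = 1 ∧ dist c a = 1

/-- The barycenter of a triangle. -/
noncomputable def barycenter (a b c : Plane) : Plane := (1 / 3 : ℝ) • (a + b + c)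

/-- The vertices of the honeycomb graph: the barycenters of all tiles. -/
def honeycombVertices : Set Plane :=
  {x | ∃ a b c : Plane, IsTile a b c ∧ x = barycenter a b c}

/-- The honeycomb graph: two distinct vertices are adjacent when their tiles share a side. -/
def honeycombGraph : SimpleGraph honeycombVertices where
  Adj x y := x ≠ y ∧ ∃ a b c c' : Plane, IsTile a b c ∧ IsTile a b c' ∧
    (x : Plane) = barycenter a b c ∧ (y : Plane) = barycenter a b c'
  symm := ⟨by
    rintro x y ⟨hne, a, b, c, c', h, h', hx, hy⟩
    exact ⟨hne.symm, a, b, c', c, h', h, hy, hx⟩⟩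
  loopless := ⟨fun _ h => h.1 rfl⟩

open Classical in
/-- The unit weight: `1` on the edges of the honeycomb graph and `0` on all other pairs. -/
noncomputable def unitWeight (x y : honeycombVertices) : ℝ :=
  if honeycombGraph.Adj x y then 1 else 0

/-- The (closed, solid) tile dual to a vertex `x`: the tile with barycenter `x`. -/
def dualCell (x : honeycombVertices) : Set Plane :=
  {p | ∃ a b c : Plane, IsTile a b c ∧ (x : Plane) = barycenter a b c ∧
    p ∈ convexHull ℝ {a, b, c}}

/-- The tiles dual to the points of `X` tessellate `S`: their union is `S`, and their interiors
are pairwise disjoint. -/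
def CellsTessellate (X : Finset honeycombVertices) (S : Set Plane) : Prop :=
  (⋃ x ∈ X, dualCell x) = S ∧
    (X : Set honeycombVertices).Pairwise
      fun x y => Disjoint (interior (dualCell x)) (interior (dualCell y))

/-! ### Counting triples with prescribed coordinates -/

/-! Three linear coordinates `ξ 0, ξ 1, ξ 2` with zero sum turn the lattice into the integer triples
of sum zero. A tile is then recorded by the integers `t i` with `t i ≤ ξ i ≤ t i + 1` on it; their
sum is `-1` or `-2`, according to the orientation of the tile. Crossing a side changes one `t i` by
`±1`.

Inequality. Let `A, B, C` be the projections of `X` to the three coordinates. The cells with a fixed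
value of one coordinate form a bi-infinite path in the graph, so each strip met by `X` contributes
an exit at both ends. Each boundary edge lies in two strips, hence the boundary has at least `|A| +
|B| + |C|` edges. On the other side, `X` embeds in the set of triples of `A × B × C` with sum `-1`
or `-2`, and `six_mul_card_tripleCells_le` bounds six times the number of such triples by `(|A| +
|B| + |C|)²`. The proof of that bound trims the minimum of `A` together with the maximum of `B`, at
a cost of at most `2|C|` triples per round, and then counts pairs; Cauchy–Davenport supplies the
gain needed when parity leaves a remainder.

Equality. All three projections then have the same even size `2k`, the trimmed sets are extremal for
Cauchy–Davenport, and rotating the roles of `A, B, C` makes all three intervals whose centres have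
sum zero: `X` is a lattice hexagon (`exists_isHexagon_of_eq`). Conversely a lattice hexagon has at
least `6k²` cells and at most `6k` boundary edges, so the inequality itself forces equality.

Geometry. If a union of cells is a regular hexagon, its corners are extreme points of a
circumscribed disc, so they are lattice points; a non-lattice point on an edge lies on a side of
some cell, which makes the edge parallel to a lattice direction (`exists_eq_hexRegion_of_iUnion`).
For the optimal constant, the three neighbour vectors have zero sum, so the constraint on `c` fixes
the size of the triangle and leaves only its position free: every admissible triangle is a
maximizer. -/

/-- The triples in `A × B × C` whose sum is `-1` or `-2`. -/
def tripleCells (A B C : Finset ℤ) : Finset (ℤ × ℤ × ℤ) :=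
  (A ×ˢ B ×ˢ C).filter fun t => t.1 + t.2.1 + t.2.2 = -1 ∨ t.1 + t.2.1 + t.2.2 = -2

lemma mem_tripleCells {A B C : Finset ℤ} {t : ℤ × ℤ × ℤ} :
    t ∈ tripleCells A B C ↔ t.1 ∈ A ∧ t.2.1 ∈ B ∧ t.2.2 ∈ C ∧
      (t.1 + t.2.1 + t.2.2 = -1 ∨ t.1 + t.2.1 + t.2.2 = -2) := by
  simp only [tripleCells, Finset.mem_filter, Finset.mem_product]
  tauto

lemma card_tripleCells_rotate (A B C : Finset ℤ) :
    (tripleCells A B C).card = (tripleCells B C A).card := by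
  refine Finset.card_bij' (fun t _ => (t.2.1, t.2.2, t.1)) (fun t _ => (t.2.2, t.1, t.2.1))
    ?_ ?_ ?_ ?_
  · rintro ⟨a, b, c⟩ h
    simp only [mem_tripleCells] at h ⊢
    refine ⟨h.2.1, h.2.2.1, h.1, ?_⟩
    omega
  · rintro ⟨a, b, c⟩ h
    simp only [mem_tripleCells] at h ⊢
    refine ⟨h.2.2.1, h.1, h.2.1, ?_⟩
    omega
  · intros; rfl
  · intros; rfl

/-- Removing the smallest element of `A` and the largest of `B` costs at most two triples for
each element of `C`. -/
lemma card_tripleCells_le_erase {A B C : Finset ℤ} {a b : ℤ} (ha : ∀ x ∈ A, a ≤ x)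
    (hb : ∀ x ∈ B, x ≤ b) :
    (tripleCells A B C).card ≤ 2 * C.card + (tripleCells (A.erase a) (B.erase b) C).card := by
  have hsub : tripleCells (A.erase a) (B.erase b) C ⊆ tripleCells A B C := by
    intro t ht
    simp only [mem_tripleCells, Finset.mem_erase] at ht ⊢
    tauto
  have hcard : (tripleCells A B C \ tripleCells (A.erase a) (B.erase b) C).card
      ≤ (C ×ˢ ({-1, -2} : Finset ℤ)).card := by
    -- A lost triple has `x` minimal or `y` maximal. Two of them with the same last coordinate and
    -- the same sum have equal `x + y`, and the extremality of `a` and `b` makes them coincide.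
    refine Finset.card_le_card_of_injOn (fun t => (t.2.2, t.1 + t.2.1 + t.2.2)) ?_ ?_
    · rintro ⟨x, y, z⟩ h
      simp only [Finset.coe_sdiff, Set.mem_sdiff, Finset.mem_coe, mem_tripleCells] at h
      simp only [Finset.coe_product, Set.mem_prod, Finset.mem_coe, Finset.mem_insert,
        Finset.mem_singleton]
      exact ⟨h.1.2.2.1, h.1.2.2.2⟩
    · rintro ⟨x, y, z⟩ h ⟨x', y', z'⟩ h' heq
      simp only [Finset.coe_sdiff, Set.mem_sdiff, Finset.mem_coe, mem_tripleCells,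
        Finset.mem_erase] at h h'
      simp only [Prod.mk.injEq] at heq ⊢
      have h1 : x = a ∨ y = b := by tauto
      have h2 : x' = a ∨ y' = b := by tauto
      have := ha _ h.1.1
      have := ha _ h'.1.1
      have := hb _ h.1.2.1
      have := hb _ h'.1.2.1
      omega
  rw [Finset.card_product] at hcard
  have := Finset.card_sdiff_add_card_eq_card hsub
  have h2 : ({-1, -2} : Finset ℤ).card = 2 := by decide
  rw [h2] at hcard
  omega

/-- This is `u` rounds of trimming. The two order clauses, that `A'` is the top part of `A` and `B'`
the bottom part of `B`, serve only the equality case, where they locate the intervals relative to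
each other. -/
lemma exists_card_tripleCells_le (C : Finset ℤ) (u : ℕ) : ∀ A B : Finset ℤ, u ≤ A.card →
    u ≤ B.card → ∃ A' ⊆ A, ∃ B' ⊆ B, A'.card + u = A.card ∧ B'.card + u = B.card ∧
      (∀ x ∈ A, x ∉ A' → ∀ y ∈ A', x < y) ∧ (∀ x ∈ B, x ∉ B' → ∀ y ∈ B', y < x) ∧
      (tripleCells A B C).card ≤ 2 * u * C.card + (tripleCells A' B' C).card := by
  induction u with
  | zero =>
    intro A B _ _
    refine ⟨A, Finset.Subset.refl _, B, Finset.Subset.refl _, by simp, by simp, ?_, ?_, by simp⟩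
    · intro x h h'; exact absurd h h'
    · intro x h h'; exact absurd h h'
  | succ u ih =>
    intro A B hA hB
    have hA0 : A.Nonempty := Finset.card_pos.1 (by omega)
    have hB0 : B.Nonempty := Finset.card_pos.1 (by omega)
    have hcA := Finset.card_erase_of_mem (A.min'_mem hA0)
    have hcB := Finset.card_erase_of_mem (B.max'_mem hB0)
    obtain ⟨A', hA', B', hB', cA, cB, tA, tB, hc⟩ := ih (A.erase (A.min' hA0))
      (B.erase (B.max' hB0)) (by omega) (by omega)
    refine ⟨A', hA'.trans (Finset.erase_subset _ _), B', hB'.trans (Finset.erase_subset _ _),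
      by omega, by omega, ?_, ?_, ?_⟩
    · intro x hx hx' y hy
      by_cases h : x = A.min' hA0
      · have := Finset.mem_erase.1 (hA' hy)
        have := A.min'_le _ this.2
        omega
      · exact tA x (Finset.mem_erase.2 ⟨h, hx⟩) hx' y hy
    · intro x hx hx' y hy
      by_cases h : x = B.max' hB0
      · have := Finset.mem_erase.1 (hB' hy)
        have := B.le_max' _ this.2
        omega
      · exact tB x (Finset.mem_erase.2 ⟨h, hx⟩) hx' y hy
    · have := card_tripleCells_le_erase (C := C) (a := A.min' hA0) (b := B.max' hB0)
        (fun x hx => A.min'_le x hx)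
        (fun x hx => B.le_max' x hx)
      calc _ ≤ _ := this
        _ ≤ 2 * C.card + (2 * u * C.card + (tripleCells A' B' C).card) := by omega
        _ = _ := by ring

/-! ### Full pairs, Cauchy–Davenport and intervals -/

/-- All triples over `A × B` with sum `-1` or `-2` have their last coordinate in `C`. -/
def FullOver (A B C : Finset ℤ) : Prop := ∀ a ∈ A, ∀ b ∈ B, -1 - a - b ∈ C ∧ -2 - a - b ∈ C

/-- A triple is determined by its first two coordinates and its sum. The bound is reached only if
each pair occurs with both sums, which is fullness. -/
lemma card_tripleCells_le (A B C : Finset ℤ) :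
    (tripleCells A B C).card ≤ 2 * (A.card * B.card) ∧
      (¬ FullOver A B C → (tripleCells A B C).card < 2 * (A.card * B.card)) := by
  set f : ℤ × ℤ × ℤ → (ℤ × ℤ) × ℤ := fun t => ((t.1, t.2.1), t.1 + t.2.1 + t.2.2)
  have hinj : Function.Injective f := by
    rintro ⟨x, y, z⟩ ⟨x', y', z'⟩ h
    simp only [f, Prod.mk.injEq] at h ⊢
    omega
  have hsub : (tripleCells A B C).image f ⊆ (A ×ˢ B) ×ˢ ({-1, -2} : Finset ℤ) := by
    intro s hs
    obtain ⟨t, ht, rfl⟩ := Finset.mem_image.1 hs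
    rw [mem_tripleCells] at ht
    simp only [f, Finset.mem_product, Finset.mem_insert, Finset.mem_singleton]
    tauto
  have hc : ((A ×ˢ B) ×ˢ ({-1, -2} : Finset ℤ)).card = 2 * (A.card * B.card) := by
    rw [Finset.card_product, Finset.card_product]
    have h2 : ({-1, -2} : Finset ℤ).card = 2 := by decide
    rw [h2]; ring
  rw [← hc, ← Finset.card_image_of_injective _ hinj]
  refine ⟨Finset.card_le_card hsub, fun hF => Finset.card_lt_card ⟨hsub, fun hs => hF ?_⟩⟩
  have key : ∀ a ∈ A, ∀ b ∈ B, ∀ s ∈ ({-1, -2} : Finset ℤ), s - a - b ∈ C := by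
    intro a ha b hb s hs'
    obtain ⟨⟨x, y, z⟩, ht, he⟩ := Finset.mem_image.1 (hs (x := ((a, b), s))
      (by simp only [Finset.mem_product]; exact ⟨⟨ha, hb⟩, hs'⟩))
    rw [mem_tripleCells] at ht
    simp only [f, Prod.mk.injEq] at he
    have : s - a - b = z := by omega
    rw [this]; exact ht.2.2.1
  exact fun a ha b hb => ⟨key a ha b hb _ (by simp), key a ha b hb _ (by simp)⟩

-- Fullness puts `A + {1, 2} + B` inside `-C`. Cauchy–Davenport is applied once or twice; the
-- summand `{1, 2}` makes up for the loss of one in the sumset bound.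
open Pointwise in
lemma FullOver.card_le {A B C : Finset ℤ} (h : FullOver A B C) (hA : A.Nonempty)
    (hB : B.Nonempty) : (A + {1, 2}).card + B.card ≤ C.card + 1 ∧
      A.card + B.card ≤ C.card := by
  have h12 : ({1, 2} : Finset ℤ).Nonempty := by simp
  have h1 := cauchy_davenport_add_of_linearOrder_isCancelAdd (hA.add h12) hB
  have h2 := cauchy_davenport_add_of_linearOrder_isCancelAdd hA h12
  have hc : ({1, 2} : Finset ℤ).card = 2 := by decide
  have hsub : (A + {1, 2} + B).card ≤ C.card := by
    refine Finset.card_le_card_of_injOn (fun x => -x) ?_ (fun x _ y _ h => neg_injective h)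
    intro x hx
    simp only [Finset.mem_coe, Finset.mem_add, Finset.mem_insert, Finset.mem_singleton] at hx
    obtain ⟨_, ⟨a, ha, e, he, rfl⟩, b, hb, rfl⟩ := hx
    have := h a ha b hb
    rcases he with rfl | rfl
    · change -(a + 1 + b) ∈ C
      rw [show -(a + 1 + b) = -1 - a - b by ring]; exact this.1
    · change -(a + 2 + b) ∈ C
      rw [show -(a + 2 + b) = -2 - a - b by ring]; exact this.2
  have := hA.card_pos
  have := hB.card_pos
  omega

-- A gap after some `x` other than the maximum would make `x + 2` an element of the sumset outside
-- the translate of `A` by `1`, in addition to the maximum plus `2`.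
open Pointwise in
lemma eq_Icc_of_card_add_le {A : Finset ℤ} (hA : A.Nonempty)
    (h : (A + {1, 2}).card ≤ A.card + 1) :
    ∃ a : ℤ, A = Finset.Icc a (a + A.card - 1) := by
  have hstep : ∀ x ∈ A, x ≠ A.max' hA → x + 1 ∈ A := by
    intro x hx hne
    by_contra hx1
    have hlt := lt_of_le_of_ne (A.le_max' x hx) hne
    have hsub : insert (x + 2) (insert (A.max' hA + 2) (A.image (· + 1))) ⊆ A + {1, 2} := by
      intro y hy
      simp only [Finset.mem_insert, Finset.mem_image] at hy
      rcases hy with rfl | rfl | ⟨z, hz, rfl⟩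
      · exact Finset.add_mem_add hx (by simp)
      · exact Finset.add_mem_add (A.max'_mem hA) (by simp)
      · exact Finset.add_mem_add hz (by simp)
    have hc := Finset.card_le_card hsub
    rw [Finset.card_insert_of_notMem, Finset.card_insert_of_notMem,
      Finset.card_image_of_injective _ (add_left_injective 1)] at hc
    · omega
    · simp only [Finset.mem_image, not_exists, not_and]
      intro z hz
      have := A.le_max' z hz
      omega
    · simp only [Finset.mem_insert, Finset.mem_image, not_or, not_exists, not_and]
      refine ⟨by omega, fun z hz hzx => hx1 ?_⟩
      have : x + 1 = z := by omega
      rwa [this]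
  have hIcc : A = Finset.Icc (A.min' hA) (A.max' hA) := by
    ext x
    rw [Finset.mem_Icc]
    refine ⟨fun hx => ⟨A.min'_le x hx, A.le_max' x hx⟩, fun ⟨h1, h2⟩ => ?_⟩
    revert h2
    refine Int.leInduction (motive := fun x _ => x ≤ A.max' hA → x ∈ A)
      (fun _ => A.min'_mem hA) (fun y _ ih hy => ?_) x h1
    exact hstep y (ih (by omega)) (by omega)
  have hle := A.min'_le _ (A.max'_mem hA)
  have hcard : A.card = (A.max' hA + 1 - A.min' hA).toNat := by
    rw [← Int.card_Icc, ← hIcc]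
  refine ⟨A.min' hA, ?_⟩
  rw [show A.min' hA + A.card - 1 = A.max' hA by omega]
  exact hIcc

/-- Trimming is worthwhile while the trimmed `A` and `B` together are larger than `C`, so the number
of rounds is half the excess. With an even excess the count of pairs suffices. With an odd one it
falls short by one half, and `C`, one element too small for a full pair, gives the missing strict
inequality. -/
lemma two_mul_card_tripleCells_le {A B C : Finset ℤ} (h1 : C.card ≤ A.card + B.card)
    (h2 : A.card ≤ B.card + C.card) (h3 : B.card ≤ A.card + C.card) :
    2 * ((tripleCells A B C).card : ℤ) ≤
      4 * A.card * B.card - (A.card + B.card - C.card) ^ 2 := by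
  obtain ⟨u, hu⟩ : ∃ u, u = (A.card + B.card - C.card) / 2 := ⟨_, rfl⟩
  obtain ⟨A', -, B', -, cA, cB, -, -, hc⟩ :=
    exists_card_tripleCells_le C u A B (by omega) (by omega)
  obtain ⟨hle, hlt⟩ := card_tripleCells_le A' B' C
  zify at cA cB hc hle hlt
  rw [← cA, ← cB]
  rcases Nat.even_or_odd' (A.card + B.card - C.card) with ⟨v, hv | hv⟩
  · have hC : (C.card : ℤ) = A'.card + B'.card := by omega
    rw [hC] at hc ⊢
    nlinarith
  · have hC : (C.card : ℤ) = A'.card + B'.card - 1 := by omega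
    have hF : ¬ FullOver A' B' C := by
      intro hF
      have := (hF.card_le (Finset.card_pos.1 (by omega)) (Finset.card_pos.1 (by omega))).2
      omega
    have := hlt hF
    rw [hC] at hc ⊢
    nlinarith

/-- After `k` rounds both trimmed sets have `k` elements and the assumed count leaves no slack, so
the pair is full over a set of the least possible size `2k`. Both trimmed sets are then intervals
and `C` is the negative of their sum with `{1, 2}`. The facts kept about `A` and `B` tie their ends
to the position of `C`. -/
lemma exists_eq_Icc_of_card_tripleCells {A B C : Finset ℤ} {k : ℕ} (hk : 1 ≤ k)
    (hA : A.card = 2 * k) (hB : B.card = 2 * k) (hC : C.card = 2 * k)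
    (h : 6 * k ^ 2 ≤ (tripleCells A B C).card) :
    ∃ a b : ℤ, a ∈ A ∧ b ∈ B ∧ a + k - 1 ∈ A ∧ (∀ x ∈ A, x ≤ a + k - 1) ∧
      (∀ x ∈ B, b ≤ x) ∧ C = Finset.Icc (-a - b - 2 * k) (-a - b - 1) := by
  obtain ⟨A', sA, B', sB, cA, cB, tA, tB, hc⟩ :=
    exists_card_tripleCells_le C k A B (by omega) (by omega)
  have cA' : A'.card = k := by omega
  have cB' : B'.card = k := by omega
  obtain ⟨hle, hlt⟩ := card_tripleCells_le A' B' C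
  rw [cA', cB'] at hle hlt
  have hF : FullOver A' B' C := by
    by_contra hF
    have := hlt hF
    rw [hC] at hc
    nlinarith
  have hF' : FullOver B' A' C := fun b hb a ha => by
    have := hF a ha b hb
    rwa [show -1 - b - a = -1 - a - b by ring, show -2 - b - a = -2 - a - b by ring]
  have nA : A'.Nonempty := Finset.card_pos.1 (by omega)
  have nB : B'.Nonempty := Finset.card_pos.1 (by omega)
  obtain ⟨a, ha⟩ := eq_Icc_of_card_add_le nA (by have := (hF.card_le nA nB).1; omega)
  obtain ⟨b, hb⟩ := eq_Icc_of_card_add_le nB (by have := (hF'.card_le nB nA).1; omega)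
  rw [cA'] at ha
  rw [cB'] at hb
  have mA : ∀ x, x ∈ A' ↔ a ≤ x ∧ x ≤ a + k - 1 := fun x => by rw [ha, Finset.mem_Icc]
  have mB : ∀ x, x ∈ B' ↔ b ≤ x ∧ x ≤ b + k - 1 := fun x => by rw [hb, Finset.mem_Icc]
  have ma : a ∈ A' := (mA a).2 (by omega)
  have mb : b ∈ B' := (mB b).2 (by omega)
  refine ⟨a, b, sA ma, sB mb, sA ((mA _).2 (by omega)), fun x hx => ?_, fun x hx => ?_, ?_⟩
  · by_cases hx' : x ∈ A'
    · exact ((mA x).1 hx').2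
    · have := tA x hx hx' a ma
      omega
  · by_cases hx' : x ∈ B'
    · exact ((mB x).1 hx').1
    · exact (tB x hx hx' b mb).le
  · symm
    refine Finset.eq_of_subset_of_card_le ?_ ?_
    · intro c hc'
      rw [Finset.mem_Icc] at hc'
      -- Reach `c` with sum `-1` from the least element of `B'` when possible, otherwise with sum
      -- `-2` from the greatest element of `A'`.
      by_cases h1 : -1 - b - c ≤ a + k - 1
      · have := (hF (-1 - b - c) ((mA _).2 (by omega)) b mb).1
        rwa [show -1 - (-1 - b - c) - b = c by ring] at this
      · have := (hF (a + k - 1) ((mA _).2 (by omega)) (-2 - (a + k - 1) - c)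
          ((mB _).2 (by omega))).2
        rwa [show -2 - (a + k - 1) - (-2 - (a + k - 1) - c) = c by ring] at this
    · rw [hC, Int.card_Icc]
      omega

/-- When the sizes satisfy the triangle inequalities, the slack left by the previous bound is at
least `2((α - β)² + (β - γ)² + (α - γ)²)`. When one size exceeds the sum of the other two, counting
pairs of those two is already strictly enough. -/
lemma six_mul_card_tripleCells_le (A B C : Finset ℤ) :
    6 * (tripleCells A B C).card ≤ (A.card + B.card + C.card) ^ 2 ∧
      (6 * (tripleCells A B C).card = (A.card + B.card + C.card) ^ 2 →
        A.card = B.card ∧ B.card = C.card) := by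
  have hAB := (card_tripleCells_le A B C).1
  have hBC := (card_tripleCells_le B C A).1
  have hCA := (card_tripleCells_le C A B).1
  rw [← card_tripleCells_rotate] at hBC
  rw [card_tripleCells_rotate] at hCA
  have h := two_mul_card_tripleCells_le (A := A) (B := B) (C := C)
  zify at *
  have pA : (0 : ℤ) ≤ A.card := by positivity
  have pB : (0 : ℤ) ≤ B.card := by positivity
  have pC : (0 : ℤ) ≤ C.card := by positivity
  generalize ((tripleCells A B C).card : ℤ) = N at *
  generalize (A.card : ℤ) = α at *
  generalize (B.card : ℤ) = β at *
  generalize (C.card : ℤ) = γ at *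
  have strict : ∀ x y z : ℤ, 0 ≤ x → 0 ≤ y → x + y < z → N ≤ 2 * (x * y) →
      6 * N < (x + y + z) ^ 2 := by
    intro x y z hx hy hz hN
    nlinarith [sq_nonneg (x - y), mul_nonneg hx hy]
  by_cases h1 : γ ≤ α + β
  · by_cases h2 : α ≤ β + γ
    · by_cases h3 : β ≤ α + γ
      · have := h h1 h2 h3
        refine ⟨by nlinarith [sq_nonneg (α - β), sq_nonneg (β - γ), sq_nonneg (α - γ)],
          fun he => ?_⟩
        have hz : (α - β) ^ 2 + (β - γ) ^ 2 + (α - γ) ^ 2 ≤ 0 := by nlinarith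
        have e1 : α - β = 0 := by
          apply pow_eq_zero_iff (two_ne_zero) |>.1
          nlinarith [sq_nonneg (α - β), sq_nonneg (β - γ), sq_nonneg (α - γ)]
        have e2 : β - γ = 0 := by
          apply pow_eq_zero_iff (two_ne_zero) |>.1
          nlinarith [sq_nonneg (α - β), sq_nonneg (β - γ), sq_nonneg (α - γ)]
        omega
      · have := strict γ α β pC pA (by omega) hCA
        rw [show γ + α + β = α + β + γ by ring] at this
        exact ⟨this.le, fun he => absurd he this.ne⟩
    · have := strict β γ α pB pC (by omega) hBC
      rw [show β + γ + α = α + β + γ by ring] at this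
      exact ⟨this.le, fun he => absurd he this.ne⟩
  · have := strict α β γ pA pB (by omega) hAB
    exact ⟨this.le, fun he => absurd he this.ne⟩

/-- The sets attaining equality are the hexagonal ones. -/
lemma exists_hexagon_of_card_tripleCells {A B C : Finset ℤ} (hA : A.Nonempty)
    (h : 6 * (tripleCells A B C).card = (A.card + B.card + C.card) ^ 2) :
    ∃ (k : ℕ) (p q r : ℤ), 1 ≤ k ∧ p + q + r = 0 ∧ A = Finset.Ico (p - k) (p + k) ∧
      B = Finset.Ico (q - k) (q + k) ∧ C = Finset.Ico (r - k) (r + k) := by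
  obtain ⟨e1, e2⟩ := (six_mul_card_tripleCells_le A B C).2 h
  obtain ⟨k, hk⟩ : Even A.card := by
    have h3 : 2 * (tripleCells A B C).card = 3 * A.card ^ 2 := by
      rw [← e2, ← e1] at h
      nlinarith
    have : Even (3 * A.card ^ 2) := ⟨(tripleCells A B C).card, by omega⟩
    rcases Nat.even_mul.1 this with h | h
    · exact absurd h (by decide)
    · exact (Nat.even_pow.1 h).1
  have hk1 : 1 ≤ k := by have := hA.card_pos; omega
  have cA : A.card = 2 * k := by omega
  have cB : B.card = 2 * k := by omega
  have cC : C.card = 2 * k := by omega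
  have hN : 6 * k ^ 2 ≤ (tripleCells A B C).card := by
    rw [cA, cB, cC] at h
    nlinarith
  have hN' := hN
  rw [card_tripleCells_rotate] at hN'
  have hN'' := hN'
  rw [card_tripleCells_rotate] at hN''
  obtain ⟨a, b, ha, hb, ha', tA, tB, hC⟩ := exists_eq_Icc_of_card_tripleCells hk1 cA cB cC hN
  obtain ⟨a1, b1, -, -, -, -, -, hA1⟩ := exists_eq_Icc_of_card_tripleCells hk1 cB cC cA hN'
  obtain ⟨a2, b2, -, -, -, -, -, hB2⟩ := exists_eq_Icc_of_card_tripleCells hk1 cC cA cB hN''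
  -- Each rotation shows that one set is an interval of length `2k`; `p` and `q` are the centres of
  -- `A` and `B`. The maximum of `A` and the minimum of `B` then fix the centre of `C` as `-p - q`.
  obtain ⟨p, hp⟩ : ∃ p, p = -a1 - b1 - k := ⟨_, rfl⟩
  obtain ⟨q, hq⟩ : ∃ q, q = -a2 - b2 - k := ⟨_, rfl⟩
  have eA : a + k - 1 = p + k - 1 := by
    have h1 := tA (p + k - 1) (by rw [hA1, Finset.mem_Icc]; omega)
    rw [hA1, Finset.mem_Icc] at ha ha'
    omega
  have eB : b = q - k := by
    have h1 := tB (q - k) (by rw [hB2, Finset.mem_Icc]; omega)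
    rw [hB2, Finset.mem_Icc] at hb
    omega
  refine ⟨k, p, q, -p - q, hk1, by ring, ?_, ?_, ?_⟩
  · rw [hA1]; ext x; simp only [Finset.mem_Icc, Finset.mem_Ico]; omega
  · rw [hB2]; ext x; simp only [Finset.mem_Icc, Finset.mem_Ico]; omega
  · rw [hC]; ext x; simp only [Finset.mem_Icc, Finset.mem_Ico]; omega

/-! ### The edge-isoperimetric inequality in integer coordinates -/

/-- Addresses of the tiles: the tile `t` is `{p : t i ≤ ξ i p ≤ t i + 1 for all i}`, where the
three triangular coordinates `ξ i` have sum zero. -/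
abbrev Cell : Type := {t : Fin 3 → ℤ // t 0 + t 1 + t 2 = -1 ∨ t 0 + t 1 + t 2 = -2}

namespace Cell

/-- The sum of the coordinates. -/
def sum (t : Cell) : ℤ := t.1 0 + t.1 1 + t.1 2

lemma sum_cases (t : Cell) : t.sum = -1 ∨ t.sum = -2 := t.2

lemma sum_eq (t : Cell) {i j k : Fin 3} (hij : i ≠ j) (hik : i ≠ k) (hjk : j ≠ k) :
    t.sum = t.1 i + t.1 j + t.1 k := by
  unfold sum
  fin_cases i <;> fin_cases j <;> fin_cases k <;> simp at hij hik hjk ⊢ <;> ring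

lemma ext_of_ne {t t' : Cell} {i j k : Fin 3} (hij : i ≠ j) (hik : i ≠ k) (hjk : j ≠ k)
    (hi : t.1 i = t'.1 i) (hj : t.1 j = t'.1 j) (hk : t.1 k = t'.1 k) : t = t' := by
  apply Subtype.ext
  funext l
  have : l = i ∨ l = j ∨ l = k := by omega
  rcases this with rfl | rfl | rfl <;> assumption

/-- The neighbour of `t` whose `i`-th coordinate differs from that of `t`. -/
def nb (i : Fin 3) (t : Cell) : Cell :=
  -- The increment is `-1` when the sum is `-1` and `+1` when it is `-2`, so the two admissible sums
  -- are exchanged.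
  ⟨fun j => t.1 j + if j = i then -3 - 2 * t.sum else 0, by
    have := t.sum_cases
    have hs : t.sum = t.1 0 + t.1 1 + t.1 2 := rfl
    fin_cases i <;> simp <;> omega⟩

lemma nb_same (i : Fin 3) (t : Cell) : (nb i t).1 i = t.1 i - 3 - 2 * t.sum := by
  simp only [nb, if_true]; ring

lemma nb_of_ne {i j : Fin 3} (h : j ≠ i) (t : Cell) : (nb i t).1 j = t.1 j := by
  simp [nb, h]

/-- The cells of `X` whose neighbour in direction `i` is not in `X`. -/
def exits (X : Finset Cell) (i : Fin 3) : Finset Cell := X.filter fun t => nb i t ∉ X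

/-- The number of boundary edges of `X`. -/
def perimeter (X : Finset Cell) : ℕ := (exits X 0).card + (exits X 1).card + (exits X 2).card

/-- In each fibre of `a` over `X`, an element of maximal height `κ` must be sent out of `X`, since
`f` stays in the fibre and raises `κ`. -/
lemma card_image_le_card_exits {τ : Type*} [DecidableEq τ] (X : Finset τ) (a κ : τ → ℤ)
    (f : τ → τ) (ha : ∀ t, a (f t) = a t) (hκ : ∀ t, κ t < κ (f t)) :
    (X.image a).card ≤ (X.filter fun t => f t ∉ X).card := by
  refine le_trans (Finset.card_le_card ?_)
    (Finset.card_image_le (s := X.filter fun t => f t ∉ X) (f := a))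
  intro y hy
  obtain ⟨t₀, ht₀, rfl⟩ := Finset.mem_image.1 hy
  obtain ⟨t, ht, hmax⟩ := Finset.exists_max_image (X.filter fun t => a t = a t₀) κ
    ⟨t₀, by simp [ht₀]⟩
  rw [Finset.mem_filter] at ht
  refine Finset.mem_image.2 ⟨t, Finset.mem_filter.2 ⟨ht.1, fun hf => ?_⟩, ht.2⟩
  have := hmax (f t) (Finset.mem_filter.2 ⟨hf, (ha t).trans ht.2⟩)
  exact absurd (hκ t) (not_lt.2 this)

/-- In a strip of constant `i`-th coordinate the cells form a path crossing sides of types `j` and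
`k` alternately, the type depending on the orientation of the cell left. Moving along it raises `t j
- t k`. Exchanging `j` and `k` traverses the strip the other way. -/
lemma card_image_coord_le (X : Finset Cell) {i j k : Fin 3} (hij : i ≠ j) (hik : i ≠ k)
    (hjk : j ≠ k) :
    (X.image fun t => t.1 i).card ≤
      ((exits X j).filter fun t => t.sum = -2).card +
        ((exits X k).filter fun t => ¬ t.sum = -2).card := by
  refine (card_image_le_card_exits X (fun t => t.1 i) (fun t => t.1 j - t.1 k)
    (fun t => if t.sum = -2 then nb j t else nb k t) ?_ ?_).trans ?_
  · intro t
    split_ifs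
    · exact nb_of_ne hij t
    · exact nb_of_ne hik t
  · intro t
    have := t.sum_cases
    split_ifs with h
    · rw [nb_same, nb_of_ne hjk.symm]; omega
    · rw [nb_same, nb_of_ne hjk]; omega
  · rw [← Finset.card_filter_add_card_filter_not (fun t : Cell => t.sum = -2)]
    refine add_le_add (Finset.card_le_card ?_) (Finset.card_le_card ?_)
    · intro t ht
      simp only [exits, Finset.mem_filter] at ht ⊢
      obtain ⟨⟨h1, h2⟩, h3⟩ := ht
      rw [if_pos h3] at h2
      exact ⟨⟨h1, h2⟩, h3⟩
    · intro t ht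
      simp only [exits, Finset.mem_filter] at ht ⊢
      obtain ⟨⟨h1, h2⟩, h3⟩ := ht
      rw [if_neg h3] at h2
      exact ⟨⟨h1, h2⟩, h3⟩

/-- There are three families of strips with two ends each, hence six inequalities. Each class of
exits, given by direction and orientation, occurs in exactly two of them, so their sum is twice the
claim. -/
lemma sum_card_image_le_perimeter (X : Finset Cell) :
    (X.image fun t => t.1 0).card + (X.image fun t => t.1 1).card +
      (X.image fun t => t.1 2).card ≤ perimeter X := by
  have h1 := card_image_coord_le X (i := 0) (j := 1) (k := 2) (by decide) (by decide) (by decide)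
  have h2 := card_image_coord_le X (i := 0) (j := 2) (k := 1) (by decide) (by decide) (by decide)
  have h3 := card_image_coord_le X (i := 1) (j := 0) (k := 2) (by decide) (by decide) (by decide)
  have h4 := card_image_coord_le X (i := 1) (j := 2) (k := 0) (by decide) (by decide) (by decide)
  have h5 := card_image_coord_le X (i := 2) (j := 0) (k := 1) (by decide) (by decide) (by decide)
  have h6 := card_image_coord_le X (i := 2) (j := 1) (k := 0) (by decide) (by decide) (by decide)
  have e (i : Fin 3) := Finset.card_filter_add_card_filter_not (s := exits X i)
    (fun t : Cell => t.sum = -2)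
  have e0 := e 0
  have e1 := e 1
  have e2 := e 2
  unfold perimeter
  omega

/-- The coordinates of a cell as a triple. -/
def toTriple (t : Cell) : ℤ × ℤ × ℤ := (t.1 0, t.1 1, t.1 2)

lemma toTriple_injective : Function.Injective toTriple := by
  intro t t' h
  simp only [toTriple, Prod.mk.injEq] at h
  exact ext_of_ne (i := 0) (j := 1) (k := 2) (by decide) (by decide) (by decide) h.1 h.2.1 h.2.2

lemma image_toTriple_subset (X : Finset Cell) :
    X.image toTriple ⊆ tripleCells (X.image fun t => t.1 0) (X.image fun t => t.1 1)
      (X.image fun t => t.1 2) := by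
  intro s hs
  obtain ⟨t, ht, rfl⟩ := Finset.mem_image.1 hs
  rw [mem_tripleCells]
  refine ⟨Finset.mem_image_of_mem _ ht, Finset.mem_image_of_mem _ ht,
    Finset.mem_image_of_mem _ ht, ?_⟩
  have := t.2
  simp only [toTriple]
  omega

theorem six_mul_card_le (X : Finset Cell) : 6 * X.card ≤ perimeter X ^ 2 := by
  have h1 := Finset.card_le_card (image_toTriple_subset X)
  rw [Finset.card_image_of_injective _ toTriple_injective] at h1
  have h2 := (six_mul_card_tripleCells_le (X.image fun t => t.1 0) (X.image fun t => t.1 1)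
      (X.image fun t => t.1 2)).1
  have h3 := Nat.pow_le_pow_left (sum_card_image_le_perimeter X) 2
  omega

/-! ### Lattice hexagons as sets of cells -/

/-- `X` is the set of all cells in the hexagon with centre `o` and side length `k`. -/
def IsHexagon (X : Finset Cell) (o : Fin 3 → ℤ) (k : ℕ) : Prop :=
  o 0 + o 1 + o 2 = 0 ∧ 1 ≤ k ∧ ∀ t : Cell, t ∈ X ↔ ∀ i, o i - k ≤ t.1 i ∧ t.1 i < o i + k

/-- Equality collapses the whole chain of estimates: `X` consists of all triples over its
projections, and these projections are extremal for the triple count. -/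
theorem exists_isHexagon_of_eq {X : Finset Cell} (hX : X.Nonempty)
    (h : 6 * X.card = perimeter X ^ 2) : ∃ o k, IsHexagon X o k := by
  have hsub := image_toTriple_subset X
  have h1 := Finset.card_le_card hsub
  rw [Finset.card_image_of_injective _ toTriple_injective] at h1
  have h2 := (six_mul_card_tripleCells_le (X.image fun t => t.1 0) (X.image fun t => t.1 1)
      (X.image fun t => t.1 2)).1
  have h3 := Nat.pow_le_pow_left (sum_card_image_le_perimeter X) 2
  have heq := Finset.eq_of_subset_of_card_le hsub (by
    rw [Finset.card_image_of_injective _ toTriple_injective]; omega)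
  obtain ⟨k, p, q, r, hk, hs, hA, hB, hC⟩ := exists_hexagon_of_card_tripleCells
    (hX.image fun t => t.1 0) (B := X.image fun t => t.1 1) (C := X.image fun t => t.1 2)
    (by omega)
  refine ⟨![p, q, r], k, by simpa using hs, hk, fun t => ?_⟩
  rw [← toTriple_injective.mem_finset_image, heq, mem_tripleCells, hA, hB, hC]
  have := t.2
  simp only [toTriple, Finset.mem_Ico, Fin.forall_fin_succ, Fin.isValue, Matrix.cons_val_zero,
    Matrix.cons_val_succ, Fin.succ_zero_eq_one, Fin.succ_one_eq_two, IsEmpty.forall_iff, and_true]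
  tauto

lemma exists_isHexagon {o : Fin 3 → ℤ} (ho : o 0 + o 1 + o 2 = 0) {k : ℕ} (hk : 1 ≤ k) :
    ∃ X, IsHexagon X o k := by
  have hf : {t : Cell | ∀ i, o i - k ≤ t.1 i ∧ t.1 i < o i + k}.Finite := by
    refine ((Set.finite_Icc (fun i => o i - (k : ℤ)) (fun i => o i + (k : ℤ))).preimage
      Subtype.val_injective.injOn).subset ?_
    intro t ht
    exact ⟨fun i => (ht i).1, fun i => (ht i).2.le⟩
  exact ⟨hf.toFinset, ho, hk, fun t => by simp⟩

/-- Exits in direction `i` lie along two opposite sides of the hexagon. Along the lower one `t j ≥ o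
j`, along the upper one `t j < o j`, so the `j`-th coordinate alone tells all these cells apart, and
it takes at most `2k` values. -/
lemma IsHexagon.card_exits_le {X : Finset Cell} {o : Fin 3 → ℤ} {k : ℕ} (h : IsHexagon X o k)
    {i j l : Fin 3} (hij : i ≠ j) (hil : i ≠ l) (hjl : j ≠ l) (ho : o i + o j + o l = 0) :
    (exits X i).card ≤ 2 * k := by
  have hc : (Finset.Ico (o j - k) (o j + k)).card = 2 * k := by rw [Int.card_Ico]; omega
  have key : ∀ t ∈ exits X i, (∀ m, o m - k ≤ t.1 m ∧ t.1 m < o m + k) ∧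
      (t.sum = -1 ∧ t.1 i = o i - k ∨ t.sum = -2 ∧ t.1 i = o i + k - 1) := by
    intro t ht
    rw [exits, Finset.mem_filter, h.2.2, h.2.2] at ht
    refine ⟨ht.1, ?_⟩
    obtain ⟨h1, h2⟩ := ht
    have hi := h1 i
    have := t.sum_cases
    by_contra hcon
    refine h2 fun m => ?_
    by_cases hm : m = i
    · subst hm
      rw [nb_same]
      omega
    · rw [nb_of_ne hm]
      exact h1 m
  rw [← hc]
  refine Finset.card_le_card_of_injOn (fun t => t.1 j) ?_ ?_
  · intro t ht
    exact Finset.mem_coe.2 (Finset.mem_Ico.2 ((key t ht).1 j))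
  · intro t ht t' ht' heq
    obtain ⟨h1, h2⟩ := key t ht
    obtain ⟨h1', h2'⟩ := key t' ht'
    have hs := t.sum_eq hij hil hjl
    have hs' := t'.sum_eq hij hil hjl
    have := h1 l
    have := h1' l
    have heq' : t.1 j = t'.1 j := heq
    refine ext_of_ne hij hil hjl ?_ heq ?_ <;> omega

/-- This is one of three rhombi into which the hexagon splits: `k` values of `t i`, `k` values of `t
j` and two sums can be chosen freely, and the third coordinate stays in range. -/
lemma IsHexagon.two_mul_sq_le {X : Finset Cell} {o : Fin 3 → ℤ} {k : ℕ} (h : IsHexagon X o k)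
    {i j l : Fin 3} (hij : i ≠ j) (hil : i ≠ l) (hjl : j ≠ l) (ho : o i + o j + o l = 0) :
    2 * k ^ 2 ≤ (X.filter fun t => o i ≤ t.1 i ∧ t.1 j < o j).card := by
  have hc : ((Finset.range k ×ˢ Finset.range k) ×ˢ (Finset.univ : Finset Bool)).card
      = 2 * k ^ 2 := by
    simp only [Finset.card_product, Finset.card_range, Finset.card_univ, Fintype.card_bool]; ring
  have hv : ∀ t : Fin 3 → ℤ, t 0 + t 1 + t 2 = t i + t j + t l := by
    intro t
    fin_cases i <;> fin_cases j <;> fin_cases l <;> simp at hij hil hjl ⊢ <;> ring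
  let s : Bool → ℤ := fun b => if b then -1 else -2
  have hs : ∀ b, s b = -1 ∨ s b = -2 := by decide
  have hsi : ∀ b b', s b = s b' → b = b' := by decide
  let f : (ℕ × ℕ) × Bool → Fin 3 → ℤ := fun z m =>
    if m = i then o i + z.1.1 else if m = j then o j - 1 - z.1.2
    else s z.2 - (o i + z.1.1) - (o j - 1 - z.1.2)
  have fi : ∀ z, f z i = o i + z.1.1 := fun z => by simp [f]
  have fj : ∀ z, f z j = o j - 1 - z.1.2 := fun z => by simp [f, hij.symm]
  have fl : ∀ z, f z l = s z.2 - (o i + z.1.1) - (o j - 1 - z.1.2) := fun z => by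
    simp [f, hil.symm, hjl.symm]
  have hf : ∀ z, f z 0 + f z 1 + f z 2 = s z.2 := fun z => by rw [hv, fi, fj, fl]; ring
  rw [← hc]
  refine Finset.card_le_card_of_injOn
    (fun z => (⟨f z, by rw [hf]; exact hs _⟩ : Cell)) ?_ ?_
  · rintro ⟨⟨u, v⟩, b⟩ hz
    simp only [Finset.coe_product, Set.mem_prod, Finset.coe_range, Set.mem_Iio] at hz
    have := hs b
    rw [Finset.mem_coe, Finset.mem_filter, h.2.2]
    dsimp only
    rw [fi, fj]
    refine ⟨fun m => ?_, by omega, by omega⟩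
    have hm : m = i ∨ m = j ∨ m = l := by omega
    rcases hm with rfl | rfl | rfl
    · rw [fi]; dsimp only; omega
    · rw [fj]; dsimp only; omega
    · rw [fl]; dsimp only; omega
  · rintro ⟨⟨u, v⟩, b⟩ - ⟨⟨u', v'⟩, b'⟩ - heq
    have heq' := congrArg Subtype.val heq
    dsimp only at heq'
    have hi := congrFun heq' i
    have hj := congrFun heq' j
    have hl := congrFun heq' l
    rw [fi, fi] at hi
    rw [fj, fj] at hj
    rw [fl, fl] at hl
    dsimp only at hi hj hl
    have hu : u = u' := by omega
    have hv : v = v' := by omega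
    have hb : s b = s b' := by omega
    rw [hu, hv, hsi b b' hb]

/-- Only one-sided counts are needed: three disjoint rhombi give at least `6k²` cells, the perimeter
is at most `6k`, and the isoperimetric inequality closes `36k² ≤ 6|X| ≤ P² ≤ 36k²`. -/
theorem IsHexagon.card_eq {X : Finset Cell} {o : Fin 3 → ℤ} {k : ℕ} (h : IsHexagon X o k) :
    X.card = 6 * k ^ 2 ∧ 6 * X.card = perimeter X ^ 2 := by
  have ho := h.1
  have a0 := h.two_mul_sq_le (i := 0) (j := 1) (l := 2) (by decide) (by decide) (by decide)
    (by omega)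
  have a1 := h.two_mul_sq_le (i := 1) (j := 2) (l := 0) (by decide) (by decide) (by decide)
    (by omega)
  have a2 := h.two_mul_sq_le (i := 2) (j := 0) (l := 1) (by decide) (by decide) (by decide)
    (by omega)
  have b0 := h.card_exits_le (i := 0) (j := 1) (l := 2) (by decide) (by decide) (by decide)
    (by omega)
  have b1 := h.card_exits_le (i := 1) (j := 2) (l := 0) (by decide) (by decide) (by decide)
    (by omega)
  have b2 := h.card_exits_le (i := 2) (j := 0) (l := 1) (by decide) (by decide) (by decide)
    (by omega)
  have hle : 6 * k ^ 2 ≤ X.card := by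
    have hd1 : Disjoint (X.filter fun t => o 0 ≤ t.1 0 ∧ t.1 1 < o 1)
        (X.filter fun t => o 1 ≤ t.1 1 ∧ t.1 2 < o 2) :=
      Finset.disjoint_filter.2 fun t _ h1 h2 => by omega
    have hd2 : Disjoint ((X.filter fun t => o 0 ≤ t.1 0 ∧ t.1 1 < o 1) ∪
        (X.filter fun t => o 1 ≤ t.1 1 ∧ t.1 2 < o 2))
        (X.filter fun t => o 2 ≤ t.1 2 ∧ t.1 0 < o 0) := by
      rw [Finset.disjoint_union_left]
      exact ⟨Finset.disjoint_filter.2 fun t _ h1 h2 => by omega,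
        Finset.disjoint_filter.2 fun t _ h1 h2 => by omega⟩
    have hsub : (((X.filter fun t => o 0 ≤ t.1 0 ∧ t.1 1 < o 1) ∪
        (X.filter fun t => o 1 ≤ t.1 1 ∧ t.1 2 < o 2)) ∪
        (X.filter fun t => o 2 ≤ t.1 2 ∧ t.1 0 < o 0)) ⊆ X :=
      Finset.union_subset (Finset.union_subset (Finset.filter_subset _ _)
        (Finset.filter_subset _ _)) (Finset.filter_subset _ _)
    have := Finset.card_le_card hsub
    rw [Finset.card_union_of_disjoint hd2, Finset.card_union_of_disjoint hd1] at this
    omega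
  have hP : perimeter X ^ 2 ≤ (6 * k) ^ 2 := Nat.pow_le_pow_left (by unfold perimeter; omega) 2
  have := six_mul_card_le X
  rw [mul_pow] at hP
  omega

end Cell

/-! ### Triangular coordinates of the plane -/

/-- The normals of the triangular coordinates. -/
noncomputable def triNormal : Fin 3 → Plane :=
  ![!₂[1, -(1 / √3)], !₂[0, 2 / √3], !₂[-1, -(1 / √3)]]

/-- The three triangular coordinates of a point; their sum is zero. -/
noncomputable def triCoord (i : Fin 3) : Plane →L[ℝ] ℝ := innerSL ℝ (triNormal i)

/-- The point with given first two triangular coordinates. -/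
noncomputable def ofTri (u v : ℝ) : Plane :=
  u • (!₂[1, 0] : Plane) + v • (!₂[1 / 2, √3 / 2] : Plane)

lemma triCoord_apply_zero (p : Plane) : triCoord 0 p = p 0 - p 1 / √3 := by
  simp [triCoord, triNormal, PiLp.inner_apply, Fin.sum_univ_two]; ring

lemma triCoord_apply_one (p : Plane) : triCoord 1 p = 2 * p 1 / √3 := by
  simp [triCoord, triNormal, PiLp.inner_apply, Fin.sum_univ_two]; ring

lemma triCoord_apply_two (p : Plane) : triCoord 2 p = -p 0 - p 1 / √3 := by
  simp [triCoord, triNormal, PiLp.inner_apply, Fin.sum_univ_two]; ring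

lemma ofTri_apply_zero (u v : ℝ) : ofTri u v 0 = u + v / 2 := by
  simp [ofTri]; ring

lemma ofTri_apply_one (u v : ℝ) : ofTri u v 1 = √3 / 2 * v := by
  simp [ofTri]; ring

lemma triCoord_sum (p : Plane) : triCoord 0 p + triCoord 1 p + triCoord 2 p = 0 := by
  rw [triCoord_apply_zero, triCoord_apply_one, triCoord_apply_two]; ring

lemma triCoord_sum_of_ne (p : Plane) {i j k : Fin 3} (hij : i ≠ j) (hik : i ≠ k)
    (hjk : j ≠ k) : triCoord i p + triCoord j p + triCoord k p = 0 := by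
  have := triCoord_sum p
  fin_cases i <;> fin_cases j <;> fin_cases k <;> simp at hij hik hjk ⊢ <;> linarith

lemma triCoord_ofTri_zero (u v : ℝ) : triCoord 0 (ofTri u v) = u := by
  rw [triCoord_apply_zero, ofTri_apply_zero, ofTri_apply_one]; field_simp; simp

lemma triCoord_ofTri_one (u v : ℝ) : triCoord 1 (ofTri u v) = v := by
  rw [triCoord_apply_one, ofTri_apply_one]; field_simp

lemma triCoord_ofTri_two (u v : ℝ) : triCoord 2 (ofTri u v) = -u - v := by
  have := triCoord_sum (ofTri u v)
  rw [triCoord_ofTri_zero, triCoord_ofTri_one] at this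
  linarith

lemma ofTri_triCoord (p : Plane) : ofTri (triCoord 0 p) (triCoord 1 p) = p := by
  ext i
  fin_cases i
  · simp [ofTri_apply_zero, triCoord_apply_zero, triCoord_apply_one]; ring
  · simp [ofTri_apply_one, triCoord_apply_one]

lemma ext_triCoord {p q : Plane} (h : ∀ i, triCoord i p = triCoord i q) : p = q := by
  rw [← ofTri_triCoord p, ← ofTri_triCoord q, h, h]

lemma triCoord_ofTri (c : Fin 3 → ℝ) (hc : c 0 + c 1 + c 2 = 0) (i : Fin 3) :
    triCoord i (ofTri (c 0) (c 1)) = c i := by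
  fin_cases i
  · exact triCoord_ofTri_zero _ _
  · exact triCoord_ofTri_one _ _
  · refine (triCoord_ofTri_two _ _).trans ?_
    simp only [Fin.reduceFinMk]
    linarith

lemma norm_sq_eq_triCoord (p : Plane) :
    ‖p‖ ^ 2 = (triCoord 0 p ^ 2 + triCoord 1 p ^ 2 + triCoord 2 p ^ 2) / 2 := by
  rw [EuclideanSpace.norm_sq_eq, Fin.sum_univ_two, triCoord_apply_zero, triCoord_apply_one,
    triCoord_apply_two, Real.norm_eq_abs, Real.norm_eq_abs, sq_abs, sq_abs]
  field_simp
  ring_nf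
  simp only [Real.sq_sqrt (show (0 : ℝ) ≤ 3 by norm_num)]
  ring

lemma inner_eq_triCoord (p q : Plane) :
    inner ℝ p q = (triCoord 0 p * triCoord 0 q + triCoord 1 p * triCoord 1 q +
      triCoord 2 p * triCoord 2 q) / 2 := by
  rw [PiLp.inner_apply, Fin.sum_univ_two]
  simp only [triCoord_apply_zero, triCoord_apply_one, triCoord_apply_two, RCLike.inner_apply,
    conj_trivial]
  field_simp
  ring_nf
  simp only [Real.sq_sqrt (show (0 : ℝ) ≤ 3 by norm_num)]
  ring

lemma dist_ofTri_eq_one_iff (a b c d : ℤ) : dist (ofTri a b) (ofTri c d) = 1 ↔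
    (c - a) ^ 2 + (c - a) * (d - b) + (d - b) ^ 2 = 1 := by
  have h : dist (ofTri a b) (ofTri c d) ^ 2 =
      (((c - a) ^ 2 + (c - a) * (d - b) + (d - b) ^ 2 : ℤ) : ℝ) := by
    rw [dist_eq_norm, norm_sq_eq_triCoord]
    simp only [map_sub, triCoord_ofTri_zero, triCoord_ofTri_one, triCoord_ofTri_two]
    push_cast
    ring
  rw [← sq_eq_sq₀ dist_nonneg zero_le_one, h, one_pow]
  exact_mod_cast Iff.rfl

/-- A triangle with sides parallel to the coordinate lines, as a convex hull. -/
lemma convexHull_triangle {τ : Fin 3 → ℝ} {l : ℝ} (hl : l ≠ 0) (hτ : τ 0 + τ 1 + τ 2 = -l)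
    {v : Fin 3 → Plane} (hv : ∀ i j, triCoord j (v i) = τ j + if i = j then l else 0) :
    convexHull ℝ (Set.range v) = {p | ∀ i, 0 ≤ (triCoord i p - τ i) / l} := by
  apply Set.Subset.antisymm
  · refine convexHull_min ?_ ?_
    · rintro _ ⟨i, rfl⟩ j
      rw [hv]
      split_ifs <;> simp [hl]
    · have : {p | ∀ i, 0 ≤ (triCoord i p - τ i) / l} =
          ⋂ i, {p : Plane | τ i / l ≤ ((1 / l) • triCoord i) p} := by
        ext p
        simp only [Set.mem_ofPred_eq, Set.mem_iInter, sub_div, sub_nonneg]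
        refine forall_congr' fun i => ?_
        simp [div_eq_inv_mul]
      rw [this]
      exact convex_iInter fun i => convex_halfSpace_ge
        (((1 / l) • triCoord i).toLinearMap.isLinear) _
  · intro p hp
    -- The quotients are the barycentric coordinates of `p`. A negative `l` gives the triangles of
    -- the opposite orientation.
    have hs : ∑ i, (triCoord i p - τ i) / l = 1 := by
      rw [Fin.sum_univ_three]
      have := triCoord_sum p
      field_simp
      linarith
    have hp' : p = ∑ i, ((triCoord i p - τ i) / l) • v i := by
      apply ext_triCoord
      intro j
      rw [map_sum]
      simp only [map_smul, hv, smul_eq_mul, mul_add, Finset.sum_add_distrib, ← Finset.sum_mul, hs]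
      simp [hl]
    rw [hp']
    exact (convex_convexHull ℝ _).sum_mem (fun i _ => hp i) hs
      fun i _ => subset_convexHull ℝ _ ⟨i, rfl⟩

/-! ### Tiles and cells -/

namespace Cell

/-- The triangular coordinates of the vertices of a tile. -/
def vertCoord (t : Cell) (i j : Fin 3) : ℤ :=
  -- The factor `3 + 2 * t.sum` is the orientation sign `±1`: for sum `-1` vertex `i` is `t + e i`,
  -- for sum `-2` it is `t + (1, 1, 1) - e i`.
  t.1 j - 1 - t.sum + if i = j then 3 + 2 * t.sum else 0

/-- The vertices of a tile. -/
noncomputable def vert (t : Cell) (i : Fin 3) : Plane :=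
  ofTri (t.vertCoord i 0) (t.vertCoord i 1)

/-- The barycenter of a tile. -/
noncomputable def center (t : Cell) : Plane :=
  ofTri (t.1 0 - t.sum / 3) (t.1 1 - t.sum / 3)

lemma vertCoord_sum (t : Cell) (i : Fin 3) :
    t.vertCoord i 0 + t.vertCoord i 1 + t.vertCoord i 2 = 0 := by
  have : t.sum = t.1 0 + t.1 1 + t.1 2 := rfl
  fin_cases i <;> simp [vertCoord] <;> omega

lemma triCoord_vert (t : Cell) (i j : Fin 3) : triCoord j (t.vert i) = t.vertCoord i j :=
  triCoord_ofTri (fun j => (t.vertCoord i j : ℝ)) (by exact_mod_cast t.vertCoord_sum i) j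

lemma triCoord_center (t : Cell) (i : Fin 3) : triCoord i t.center = t.1 i - t.sum / 3 := by
  refine triCoord_ofTri (fun i => (t.1 i - t.sum / 3 : ℝ)) ?_ i
  have : t.sum = t.1 0 + t.1 1 + t.1 2 := rfl
  rw [this]; push_cast; ring

lemma center_mem_Ioo (t : Cell) (i : Fin 3) :
    (t.1 i : ℝ) < triCoord i t.center ∧ triCoord i t.center < t.1 i + 1 := by
  rw [triCoord_center]
  rcases t.sum_cases with h | h <;> rw [h] <;> push_cast <;> constructor <;> linarith

lemma center_injective : Function.Injective center := by
  intro t t' h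
  apply Subtype.ext
  funext i
  have h1 := t.center_mem_Ioo i
  have h2 := t'.center_mem_Ioo i
  rw [h] at h1
  have a1 : (t.1 i : ℝ) < (t'.1 i + 1 : ℤ) := by push_cast; linarith
  have a2 : (t'.1 i : ℝ) < (t.1 i + 1 : ℤ) := by push_cast; linarith
  have a1' := Int.cast_lt.1 a1
  have a2' := Int.cast_lt.1 a2
  omega

lemma barycenter_vert (t : Cell) {i j k : Fin 3} (hij : i ≠ j) (hik : i ≠ k) (hjk : j ≠ k) :
    barycenter (t.vert i) (t.vert j) (t.vert k) = t.center := by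
  apply ext_triCoord
  intro l
  have hl : l = i ∨ l = j ∨ l = k := by omega
  rw [barycenter, map_smul, map_add, map_add, triCoord_vert, triCoord_vert, triCoord_vert,
    triCoord_center, smul_eq_mul]
  rcases hl with rfl | rfl | rfl <;>
    simp [vertCoord, hij, hik, hjk, hij.symm, hik.symm, hjk.symm] <;> ring

lemma range_vert (t : Cell) {i j k : Fin 3} (hij : i ≠ j) (hik : i ≠ k) (hjk : j ≠ k) :
    Set.range t.vert = {t.vert i, t.vert j, t.vert k} := by
  ext p
  simp only [Set.mem_range, Set.mem_insert_iff, Set.mem_singleton_iff]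
  constructor
  · rintro ⟨l, rfl⟩
    have hl : l = i ∨ l = j ∨ l = k := by omega
    rcases hl with rfl | rfl | rfl <;> simp
  · rintro (rfl | rfl | rfl) <;> exact ⟨_, rfl⟩

lemma convexHull_vert (t : Cell) :
    convexHull ℝ (Set.range t.vert) =
      {p | ∀ i, (t.1 i : ℝ) ≤ triCoord i p ∧ triCoord i p ≤ t.1 i + 1} := by
  have hsum : t.sum = t.1 0 + t.1 1 + t.1 2 := rfl
  have hsum' : (t.sum : ℝ) = t.1 0 + t.1 1 + t.1 2 := by rw [hsum]; push_cast; ring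
  rw [convexHull_triangle (τ := fun j => t.1 j - 1 - t.sum) (l := 3 + 2 * t.sum) (v := t.vert)]
  · ext p
    have hp := triCoord_sum p
    simp only [Set.mem_ofPred_eq, Fin.forall_fin_succ, Fin.isValue, Fin.succ_zero_eq_one,
      Fin.succ_one_eq_two, IsEmpty.forall_iff, and_true]
    rcases t.sum_cases with h | h <;> rw [h] at hsum' ⊢ <;> push_cast at hsum' ⊢ <;> norm_num <;>
      constructor <;> intro hh <;> (try refine ⟨⟨?_, ?_⟩, ⟨?_, ?_⟩, ?_, ?_⟩) <;>
      (try refine ⟨?_, ?_, ?_⟩) <;> linarith [hh.1, hh.2.1, hh.2.2]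
  · rcases t.sum_cases with h | h <;> rw [h] <;> norm_num
  · rw [hsum']; ring
  · intro i j
    rw [triCoord_vert, vertCoord]
    push_cast
    rfl

end Cell

/-! ### Tiles of the tessellation are exactly the cells -/

namespace Cell

lemma vert_mem_triangularLattice (t : Cell) (i : Fin 3) : t.vert i ∈ triangularLattice :=
  ⟨t.vertCoord i 0, t.vertCoord i 1, rfl⟩

lemma dist_vert (t : Cell) {i j : Fin 3} (hij : i ≠ j) : dist (t.vert i) (t.vert j) = 1 := by
  rw [vert, vert, dist_ofTri_eq_one_iff]
  rcases t.sum_cases with h | h <;> revert hij <;> fin_cases i <;> fin_cases j <;>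
    simp [vertCoord, h]

lemma isTile_vert (t : Cell) {i j k : Fin 3} (hij : i ≠ j) (hik : i ≠ k) (hjk : j ≠ k) :
    IsTile (t.vert i) (t.vert j) (t.vert k) :=
  ⟨t.vert_mem_triangularLattice i, t.vert_mem_triangularLattice j,
    t.vert_mem_triangularLattice k, t.dist_vert hij, t.dist_vert hjk, t.dist_vert hik.symm⟩

end Cell

lemma unit_vector_cases {m n : ℤ} (h : m ^ 2 + m * n + n ^ 2 = 1) :
    (m = 1 ∧ n = 0) ∨ (m = 0 ∧ n = 1) ∨ (m = -1 ∧ n = 1) ∨ (m = -1 ∧ n = 0) ∨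
      (m = 0 ∧ n = -1) ∨ (m = 1 ∧ n = -1) := by
  have h1 : m ≤ 1 := by nlinarith [sq_nonneg (m + 2 * n), sq_nonneg (m - 2)]
  have h2 : -1 ≤ m := by nlinarith [sq_nonneg (m + 2 * n), sq_nonneg (m + 2)]
  have h3 : n ≤ 1 := by nlinarith [sq_nonneg (n + 2 * m), sq_nonneg (n - 2)]
  have h4 : -1 ≤ n := by nlinarith [sq_nonneg (n + 2 * m), sq_nonneg (n + 2)]
  interval_cases m <;> interval_cases n <;> simp_all

/-- Two unit vectors of the lattice at unit distance span a tile. -/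
lemma exists_of_unit_vectors {m n m' n' : ℤ} (h : m ^ 2 + m * n + n ^ 2 = 1)
    (h' : m' ^ 2 + m' * n' + n' ^ 2 = 1)
    (hd : (m' - m) ^ 2 + (m' - m) * (n' - n) + (n' - n) ^ 2 = 1) :
    ∃ (b : Bool) (i j k : Fin 3), i ≠ j ∧ i ≠ k ∧ j ≠ k ∧
      m = (if b then 1 else -1) * ((if j = 0 then 1 else 0) - if i = 0 then 1 else 0) ∧
      n = (if b then 1 else -1) * ((if j = 1 then 1 else 0) - if i = 1 then 1 else 0) ∧
      m' = (if b then 1 else -1) * ((if k = 0 then 1 else 0) - if i = 0 then 1 else 0) ∧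
      n' = (if b then 1 else -1) * ((if k = 1 then 1 else 0) - if i = 1 then 1 else 0) := by
  rcases unit_vector_cases h with ⟨rfl, rfl⟩ | ⟨rfl, rfl⟩ | ⟨rfl, rfl⟩ | ⟨rfl, rfl⟩ |
    ⟨rfl, rfl⟩ | ⟨rfl, rfl⟩ <;>
  rcases unit_vector_cases h' with ⟨rfl, rfl⟩ | ⟨rfl, rfl⟩ | ⟨rfl, rfl⟩ | ⟨rfl, rfl⟩ |
    ⟨rfl, rfl⟩ | ⟨rfl, rfl⟩ <;>
  first
    | (exfalso; revert hd; decide)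
    | decide

lemma IsTile.exists_cell {a b c : Plane} (h : IsTile a b c) :
    ∃ (t : Cell) (i j k : Fin 3), i ≠ j ∧ i ≠ k ∧ j ≠ k ∧
      a = t.vert i ∧ b = t.vert j ∧ c = t.vert k := by
  obtain ⟨⟨a0, a1, ha⟩, ⟨b0, b1, hb⟩, ⟨c0, c1, hc⟩, hab, hbc, hca⟩ := h
  change a = ofTri a0 a1 at ha
  change b = ofTri b0 b1 at hb
  change c = ofTri c0 c1 at hc
  subst ha hb hc
  rw [dist_comm] at hca
  rw [dist_ofTri_eq_one_iff] at hab hbc hca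
  obtain ⟨e, i, j, k, hij, hik, hjk, h1, h2, h3, h4⟩ := exists_of_unit_vectors hab hca
    (by rw [← hbc]; ring)
  obtain ⟨a2, ha2⟩ : ∃ a2, a0 + a1 + a2 = 0 := ⟨-a0 - a1, by ring⟩
  let s : ℤ := if e then -1 else -2
  have hs : s = -1 ∨ s = -2 := by cases e <;> simp [s]
  have he : (if e then 1 else -1) = 3 + 2 * s := by cases e <;> simp [s]
  rw [he] at h1 h2 h3 h4
  -- The sign of the edge vectors gives the orientation `s`; solving the formula for vertex `i`,
  -- which is to be `a`, gives the address.
  let f : Fin 3 → ℤ := fun l => ![a0, a1, a2] l + 1 + s - if i = l then 3 + 2 * s else 0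
  have hf : f 0 + f 1 + f 2 = s := by
    have h0 : f 0 = a0 + 1 + s - if i = 0 then 3 + 2 * s else 0 := rfl
    have h1 : f 1 = a1 + 1 + s - if i = 1 then 3 + 2 * s else 0 := rfl
    have h2 : f 2 = a2 + 1 + s - if i = 2 then 3 + 2 * s else 0 := rfl
    rw [h0, h1, h2]
    clear * - ha2
    fin_cases i <;> simp <;> omega
  let t : Cell := ⟨f, by rw [hf]; exact hs⟩
  have ht : t.sum = s := hf
  have hv : ∀ l m, t.vertCoord l m = ![a0, a1, a2] m +
      (3 + 2 * s) * ((if l = m then 1 else 0) - if i = m then 1 else 0) := by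
    intro l m
    simp only [Cell.vertCoord, ht]
    change f m - 1 - s + _ = _
    simp only [f]
    split_ifs <;> ring
  refine ⟨t, i, j, k, hij, hik, hjk, ?_, ?_, ?_⟩
  · rw [Cell.vert, hv, hv]; simp
  · rw [Cell.vert, hv, hv, ← h1, ← h2]; simp
  · rw [Cell.vert, hv, hv, ← h3, ← h4]; simp

/-! ### The honeycomb graph in cell coordinates -/

namespace Cell

lemma center_mem_honeycombVertices (t : Cell) : t.center ∈ honeycombVertices :=
  ⟨_, _, _, t.isTile_vert (i := 0) (j := 1) (k := 2) (by decide) (by decide) (by decide),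
    (t.barycenter_vert (by decide) (by decide) (by decide)).symm⟩

/-- The cells are the vertices of the honeycomb graph. -/
noncomputable def equivVertices : Cell ≃ honeycombVertices :=
  Equiv.ofBijective (fun t => ⟨t.center, t.center_mem_honeycombVertices⟩) <| by
    refine ⟨fun t t' h => center_injective (congrArg Subtype.val h), ?_⟩
    rintro ⟨x, a, b, c, h, rfl⟩
    obtain ⟨t, i, j, k, hij, hik, hjk, rfl, rfl, rfl⟩ := h.exists_cell
    exact ⟨t, Subtype.ext (t.barycenter_vert hij hik hjk).symm⟩

lemma coe_equivVertices (t : Cell) : (equivVertices t : Plane) = t.center := rfl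

lemma dualCell_equivVertices (t : Cell) :
    dualCell (equivVertices t) = convexHull ℝ (Set.range t.vert) := by
  ext p
  constructor
  · rintro ⟨a, b, c, h, hx, hp⟩
    obtain ⟨t', i, j, k, hij, hik, hjk, rfl, rfl, rfl⟩ := h.exists_cell
    rw [barycenter_vert _ hij hik hjk, coe_equivVertices] at hx
    rw [center_injective hx, range_vert _ hij hik hjk]
    exact hp
  · intro hp
    refine ⟨_, _, _, t.isTile_vert (i := 0) (j := 1) (k := 2) (by decide) (by decide)
      (by decide), (t.barycenter_vert (by decide) (by decide) (by decide)).symm, ?_⟩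
    rwa [← range_vert _ (by decide) (by decide) (by decide)]

lemma mem_dualCell_iff (t : Cell) (p : Plane) : p ∈ dualCell (equivVertices t) ↔
    ∀ i, (t.1 i : ℝ) ≤ triCoord i p ∧ triCoord i p ≤ t.1 i + 1 := by
  rw [dualCell_equivVertices, convexHull_vert]; rfl

lemma sum_nb (i : Fin 3) (t : Cell) : (nb i t).sum = -3 - t.sum := by
  have h0 : t.sum = t.1 0 + t.1 1 + t.1 2 := rfl
  have h1 : (nb i t).sum = (nb i t).1 0 + (nb i t).1 1 + (nb i t).1 2 := rfl
  rw [h1]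
  fin_cases i <;> simp [nb] <;> omega

lemma nb_ne (i : Fin 3) (t : Cell) : nb i t ≠ t := by
  intro h
  have h1 := sum_nb i t
  rw [h] at h1
  omega

lemma nb_inj {i j : Fin 3} {t : Cell} (h : nb i t = nb j t) : i = j := by
  by_contra hij
  have h1 : (nb i t).1 i = (nb j t).1 i := by rw [h]
  rw [nb_same, nb_of_ne hij] at h1
  omega

lemma vert_eq_iff (t t' : Cell) (i j : Fin 3) :
    t.vert i = t'.vert j ↔ ∀ l, t.vertCoord i l = t'.vertCoord j l := by
  constructor
  · intro h l
    have := congrArg (triCoord l) h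
    rw [triCoord_vert, triCoord_vert] at this
    exact_mod_cast this
  · intro h
    rw [vert, vert, h, h]

/-- Neighbours share the side opposite vertex `i`, but its two ends exchange labels. -/
lemma vert_nb (t : Cell) {i j k : Fin 3} (hij : i ≠ j) (hik : i ≠ k) (hjk : j ≠ k) :
    (nb i t).vert j = t.vert k := by
  rw [vert_eq_iff]
  intro l
  simp only [vertCoord, sum_nb]
  simp only [nb]
  have hl : l = i ∨ l = j ∨ l = k := by omega
  have hs := t.sum_cases
  rcases hl with rfl | rfl | rfl <;>
    simp [hjk, hij.symm, hik.symm, hjk.symm] <;> omega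

/-- Two common vertices of cells with the same orientation must carry the same labels, which makes
the cells equal. With opposite orientations the labels are exchanged, and the coordinates are those
of the neighbour. -/
lemma eq_nb_of_vert_eq {t t' : Cell} (hne : t ≠ t') {i j k i' j' : Fin 3} (hij : i ≠ j)
    (hik : i ≠ k) (hjk : j ≠ k) (h1 : t.vert i = t'.vert i') (h2 : t.vert j = t'.vert j') :
    t' = nb k t := by
  rw [vert_eq_iff] at h1 h2
  have hs := t.sum_cases
  have hs' := t'.sum_cases
  simp only [vertCoord] at h1 h2
  have a1 := h1 i
  have a2 := h1 j
  have a3 := h1 k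
  have b1 := h2 i
  have b2 := h2 j
  have b3 := h2 k
  simp only [hij, hik, hjk, hij.symm, if_true, if_false] at a1 a2 a3 b1 b2 b3
  by_cases hss : t.sum = t'.sum
  · exfalso
    apply hne
    rw [hss] at a1 a2 a3 b1 b2 b3
    have hi : i' = i := by
      by_contra hi
      rw [if_neg hi] at a1
      split_ifs at b1 <;> omega
    subst hi
    rw [if_neg hij] at a2
    rw [if_neg hik] at a3
    rw [if_pos rfl] at a1
    exact ext_of_ne hij hik hjk (by omega) (by omega) (by omega)
  · have hi : i' = j := by
      by_contra hi
      rw [if_neg hi] at a2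
      split_ifs at b2 <;> omega
    subst hi
    rw [if_neg hij.symm] at a1
    rw [if_neg hjk] at a3
    rw [if_pos rfl] at a2
    refine ext_of_ne hij hik hjk ?_ ?_ ?_
    · rw [nb_of_ne hik]; omega
    · rw [nb_of_ne hjk]; omega
    · rw [nb_same]; omega

lemma adj_equivVertices_iff (t t' : Cell) :
    honeycombGraph.Adj (equivVertices t) (equivVertices t') ↔ ∃ i, t' = nb i t := by
  constructor
  · rintro ⟨hne, a, b, c, c', h, h', hx, hy⟩
    have hne' : t ≠ t' := fun e => hne (congrArg _ e)
    obtain ⟨u, i, j, k, hij, hik, hjk, rfl, rfl, rfl⟩ := h.exists_cell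
    obtain ⟨u', i', j', k', hij', hik', hjk', e1, e2, e3⟩ := h'.exists_cell
    rw [coe_equivVertices, barycenter_vert _ hij hik hjk] at hx
    rw [coe_equivVertices, e1, e2, e3, barycenter_vert _ hij' hik' hjk'] at hy
    rw [← center_injective hx] at e1 e2
    rw [← center_injective hy] at e1 e2
    exact ⟨k, eq_nb_of_vert_eq hne' hij hik hjk e1 e2⟩
  · rintro ⟨i, rfl⟩
    refine ⟨fun h => nb_ne i t (equivVertices.injective h).symm, ?_⟩
    obtain ⟨j, k, hij, hik, hjk⟩ : ∃ j k, i ≠ j ∧ i ≠ k ∧ j ≠ k := by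
      clear t; revert i; decide
    refine ⟨t.vert j, t.vert k, t.vert i, (nb i t).vert i,
      t.isTile_vert hjk hij.symm hik.symm, ?_, (t.barycenter_vert hjk hij.symm hik.symm).symm, ?_⟩
    · rw [← vert_nb t hij hik hjk, ← vert_nb t hik hij hjk.symm]
      exact (nb i t).isTile_vert hjk.symm hik.symm hij.symm
    · rw [← vert_nb t hij hik hjk, ← vert_nb t hik hij hjk.symm]
      exact ((nb i t).barycenter_vert hjk.symm hik.symm hij.symm).symm

lemma unitWeight_ne_zero_iff (t t' : Cell) :
    unitWeight (equivVertices t) (equivVertices t') ≠ 0 ↔ ∃ i, t' = nb i t := by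
  rw [← adj_equivVertices_iff, unitWeight]
  split_ifs with h <;> simp [h]

lemma unitWeight_nb (t : Cell) (i : Fin 3) :
    unitWeight (equivVertices t) (equivVertices (nb i t)) = 1 :=
  if_pos ((adj_equivVertices_iff _ _).2 ⟨i, rfl⟩)

/-- The number of oriented boundary edges is the perimeter. -/
lemma ncard_orientedBoundary (X : Finset Cell) :
    (orientedBoundary unitWeight (X.map equivVertices.toEmbedding)).ncard = perimeter X := by
  have hmem : ∀ t, equivVertices t ∈ X.map equivVertices.toEmbedding ↔ t ∈ X := fun t =>
    Finset.mem_map' equivVertices.toEmbedding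
  let f : Cell × Fin 3 → honeycombVertices × honeycombVertices := fun z =>
    (equivVertices z.1, equivVertices (nb z.2 z.1))
  have hf : Function.Injective f := by
    rintro ⟨t, i⟩ ⟨t', i'⟩ h
    simp only [f, Prod.mk.injEq, EmbeddingLike.apply_eq_iff_eq] at h
    obtain ⟨rfl, h⟩ := h
    rw [nb_inj h]
  have hset : orientedBoundary unitWeight (X.map equivVertices.toEmbedding) =
      f '' ((X ×ˢ Finset.univ).filter fun z => nb z.2 z.1 ∉ X : Finset (Cell × Fin 3)) := by
    ext ⟨x, y⟩
    obtain ⟨t, rfl⟩ := equivVertices.surjective x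
    obtain ⟨t', rfl⟩ := equivVertices.surjective y
    simp only [orientedBoundary, Set.mem_ofPred_eq, hmem, unitWeight_ne_zero_iff, Set.mem_image,
      Finset.coe_filter, Finset.mem_product, Finset.mem_univ, and_true, f, Prod.mk.injEq,
      EmbeddingLike.apply_eq_iff_eq, Prod.exists]
    constructor
    · rintro ⟨h1, h2, i, rfl⟩
      exact ⟨t, i, ⟨h1, h2⟩, rfl, rfl⟩
    · rintro ⟨_, i, ⟨h1, h2⟩, rfl, rfl⟩
      exact ⟨h1, h2, i, rfl⟩
  rw [hset, Set.ncard_image_of_injective _ hf, Set.ncard_coe_finset, Finset.card_filter,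
    Finset.sum_product_right]
  simp only [← Finset.card_filter, Fin.sum_univ_three]
  rfl

end Cell

/-! ### Areas -/

/-- Fubini with horizontal slices; it serves for both the triangles and the hexagon `H`. -/
lemma volume_region_between {f g : ℝ → ℝ} (hf : Continuous f) (hg : Continuous g) {u v : ℝ}
    (huv : u ≤ v) (hfg : ∀ y ∈ Set.Icc u v, f y ≤ g y) :
    volume {p : Plane | p 1 ∈ Set.Icc u v ∧ f (p 1) ≤ p 0 ∧ p 0 ≤ g (p 1)} =
      ENNReal.ofReal (∫ y in u..v, (g y - f y)) := by
  let e : Plane ≃ᵐ ℝ × ℝ :=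
    (MeasurableEquiv.toLp 2 (Fin 2 → ℝ)).symm.trans MeasurableEquiv.finTwoArrow
  have he : MeasurePreserving e volume volume :=
    (volume_preserving_finTwoArrow ℝ).comp
      (EuclideanSpace.volume_preserving_symm_measurableEquiv_toLp (Fin 2))
  let T : Set (ℝ × ℝ) := {q | q.2 ∈ Set.Icc u v ∧ f q.2 ≤ q.1 ∧ q.1 ≤ g q.2}
  have hT : MeasurableSet T := by
    refine IsClosed.measurableSet ?_
    refine (isClosed_Icc.preimage continuous_snd).inter (IsClosed.inter ?_ ?_)
    · exact isClosed_le (hf.comp continuous_snd) continuous_fst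
    · exact isClosed_le continuous_fst (hg.comp continuous_snd)
  have hS : {p : Plane | p 1 ∈ Set.Icc u v ∧ f (p 1) ≤ p 0 ∧ p 0 ≤ g (p 1)} = e ⁻¹' T := rfl
  rw [hS, he.measure_preimage_equiv, Measure.volume_eq_prod, Measure.prod_apply_symm hT]
  have hslice : ∀ y, volume ((fun x => (x, y)) ⁻¹' T) =
      (Set.Icc u v).indicator (fun y => ENNReal.ofReal (g y - f y)) y := by
    intro y
    by_cases hy : y ∈ Set.Icc u v
    · rw [Set.indicator_of_mem hy, ← Real.volume_Icc]
      congr 1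
      ext x
      exact ⟨fun h => h.2, fun h => ⟨hy, h⟩⟩
    · rw [Set.indicator_of_notMem hy]
      convert measure_empty (μ := (volume : Measure ℝ))
      ext x
      exact ⟨fun h => hy h.1, fun h => h.elim⟩
  rw [lintegral_congr hslice, lintegral_indicator measurableSet_Icc,
    intervalIntegral.integral_of_le huv, ← integral_Icc_eq_integral_Ioc,
    ofReal_integral_eq_lintegral_ofReal]
  · exact (hg.sub hf).integrableOn_Icc
  · exact (ae_restrict_iff' measurableSet_Icc).2
      (Filter.Eventually.of_forall fun y hy => sub_nonneg.2 (hfg y hy))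

lemma sqrt_three_pos : 0 < √(3 : ℝ) := Real.sqrt_pos.2 (by norm_num)

lemma triCoord_eq_div (p : Plane) : triCoord 0 p = p 0 - p 1 / √3 ∧
    triCoord 1 p = 2 * (p 1 / √3) ∧ triCoord 2 p = -p 0 - p 1 / √3 :=
  ⟨triCoord_apply_zero p, by rw [triCoord_apply_one]; ring, triCoord_apply_two p⟩

lemma integral_affine_div (a b c d e : ℝ) :
    ∫ y in (√3 * a)..(√3 * b), (c + d * (y / √3) + e * (y / √3)) =
      √3 * ((b - a) * c + (d + e) * (b ^ 2 - a ^ 2) / 2) := by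
  have h := sqrt_three_pos
  have h2 : ∀ y : ℝ, c + d * (y / √3) + e * (y / √3) = c + ((d + e) / √3) * y := by
    intro y; ring
  simp only [h2]
  rw [intervalIntegral.integral_add (by simp) (by
    exact (continuous_const.mul continuous_id).intervalIntegrable _ _),
    intervalIntegral.integral_const, intervalIntegral.integral_const_mul, integral_id]
  simp only [smul_eq_mul]
  field_simp

lemma volume_triangle {τ : Fin 3 → ℝ} {l : ℝ} (hl : l = 2 ∨ l = -2)
    (hτ : τ 0 + τ 1 + τ 2 = -l) :
    volume {p : Plane | ∀ i, 0 ≤ (triCoord i p - τ i) / l} = ENNReal.ofReal √3 := by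
  have h := sqrt_three_pos
  rcases hl with rfl | rfl
  · have hS : {p : Plane | ∀ i, 0 ≤ (triCoord i p - τ i) / 2} =
        {p : Plane | p 1 ∈ Set.Icc (√3 * (τ 1 / 2)) (√3 * (τ 1 / 2 + 1)) ∧
          τ 0 + p 1 / √3 ≤ p 0 ∧ p 0 ≤ -τ 2 - p 1 / √3} := by
      ext p
      obtain ⟨h0, h1, h2⟩ := triCoord_eq_div p
      simp only [Set.mem_ofPred_eq, Fin.forall_fin_succ, Fin.isValue, Fin.succ_zero_eq_one,
        Fin.succ_one_eq_two, IsEmpty.forall_iff, and_true, h0, h1, h2, Set.mem_Icc,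
        ← le_div_iff₀' h, ← div_le_iff₀' h]
      constructor
      · rintro ⟨a, b, c⟩
        refine ⟨⟨?_, ?_⟩, ?_, ?_⟩ <;> linarith
      · rintro ⟨⟨a, b⟩, c, d⟩
        refine ⟨?_, ?_, ?_⟩ <;> linarith
    rw [hS, volume_region_between (f := fun y => τ 0 + y / √3) (g := fun y => -τ 2 - y / √3)
      (by fun_prop) (by fun_prop)]
    · congr 1
      have : ∀ y : ℝ, (-τ 2 - y / √3) - (τ 0 + y / √3) =
          (-τ 2 - τ 0) + (-1) * (y / √3) + (-1) * (y / √3) := by intro y; ring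
      simp only [this]
      rw [integral_affine_div, show τ 2 = -2 - τ 0 - τ 1 by linarith]
      ring
    · nlinarith
    · intro y hy
      rw [Set.mem_Icc, ← div_le_iff₀' h, ← le_div_iff₀' h] at hy
      linarith [hy.2]
  · have hS : {p : Plane | ∀ i, 0 ≤ (triCoord i p - τ i) / (-2)} =
        {p : Plane | p 1 ∈ Set.Icc (√3 * (τ 1 / 2 - 1)) (√3 * (τ 1 / 2)) ∧
          -τ 2 - p 1 / √3 ≤ p 0 ∧ p 0 ≤ τ 0 + p 1 / √3} := by
      ext p
      obtain ⟨h0, h1, h2⟩ := triCoord_eq_div p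
      simp only [Set.mem_ofPred_eq, Fin.forall_fin_succ, Fin.isValue, Fin.succ_zero_eq_one,
        Fin.succ_one_eq_two, IsEmpty.forall_iff, and_true, h0, h1, h2, Set.mem_Icc,
        ← le_div_iff₀' h, ← div_le_iff₀' h]
      constructor
      · rintro ⟨a, b, c⟩
        refine ⟨⟨?_, ?_⟩, ?_, ?_⟩ <;> linarith
      · rintro ⟨⟨a, b⟩, c, d⟩
        refine ⟨?_, ?_, ?_⟩ <;> linarith
    rw [hS, volume_region_between (f := fun y => -τ 2 - y / √3) (g := fun y => τ 0 + y / √3)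
      (by fun_prop) (by fun_prop)]
    · congr 1
      have : ∀ y : ℝ, (τ 0 + y / √3) - (-τ 2 - y / √3) =
          (τ 2 + τ 0) + 1 * (y / √3) + 1 * (y / √3) := by intro y; ring
      simp only [this]
      rw [integral_affine_div, show τ 2 = 2 - τ 0 - τ 1 by linarith]
      ring
    · nlinarith
    · intro y hy
      rw [Set.mem_Icc, ← div_le_iff₀' h, ← le_div_iff₀' h] at hy
      linarith [hy.1]

/-! ### Hexagons -/

/-- The hexagon with centre `o` and side length `k` whose sides are parallel to the lattice. -/
def hexRegion (o : Plane) (k : ℝ) : Set Plane := {p | ∀ i, |triCoord i p - triCoord i o| ≤ k}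

lemma volume_hexRegion_two : volume (hexRegion 0 2) = ENNReal.ofReal (6 * √3) := by
  have h := sqrt_three_pos
  have hS : hexRegion 0 2 = {p : Plane | p 1 ∈ Set.Icc (√3 * (-1)) (√3 * 1) ∧
          |p 1 / √3| - 2 ≤ p 0 ∧ p 0 ≤ 2 - |p 1 / √3|} := by
    ext p
    obtain ⟨h0, h1, h2⟩ := triCoord_eq_div p
    simp only [hexRegion, Set.mem_ofPred_eq, Fin.forall_fin_succ, Fin.isValue,
      Fin.succ_zero_eq_one, Fin.succ_one_eq_two, IsEmpty.forall_iff, and_true, h0, h1, h2,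
      Set.mem_Icc, ← le_div_iff₀' h, ← div_le_iff₀' h, map_zero, sub_zero, abs_le]
    rcases abs_cases (p 1 / √3) with ⟨ha, hb⟩ | ⟨ha, hb⟩ <;> rw [ha]
    all_goals
      constructor
      · rintro ⟨⟨a, a'⟩, ⟨b, b'⟩, c, c'⟩
        refine ⟨⟨?_, ?_⟩, ?_, ?_⟩ <;> linarith
      · rintro ⟨⟨a, b⟩, c, d⟩
        refine ⟨⟨?_, ?_⟩, ⟨?_, ?_⟩, ?_, ?_⟩ <;> linarith
  rw [hS, volume_region_between (f := fun y => |y / √3| - 2) (g := fun y => 2 - |y / √3|)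
      (by fun_prop) (by fun_prop)]
  · congr 1
    have hc : Continuous fun y : ℝ => (2 - |y / √3|) - (|y / √3| - 2) := by fun_prop
    rw [← intervalIntegral.integral_add_adjacent_intervals (b := √3 * 0)
      (hc.intervalIntegrable _ _) (hc.intervalIntegrable _ _)]
    have e1 : ∫ y in (√3 * (-1))..(√3 * 0), ((2 - |y / √3|) - (|y / √3| - 2)) =
        ∫ y in (√3 * (-1))..(√3 * 0), (4 + 1 * (y / √3) + 1 * (y / √3)) := by
      refine intervalIntegral.integral_congr fun y hy => ?_
      rw [Set.uIcc_of_le (by nlinarith), Set.mem_Icc, mul_zero] at hy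
      rw [abs_of_nonpos (div_nonpos_of_nonpos_of_nonneg hy.2 h.le)]; ring
    have e2 : ∫ y in (√3 * 0)..(√3 * 1), ((2 - |y / √3|) - (|y / √3| - 2)) =
        ∫ y in (√3 * 0)..(√3 * 1), (4 + (-1) * (y / √3) + (-1) * (y / √3)) := by
      refine intervalIntegral.integral_congr fun y hy => ?_
      rw [Set.uIcc_of_le (by nlinarith), Set.mem_Icc, mul_zero] at hy
      rw [abs_of_nonneg (div_nonneg hy.1 h.le)]; ring
    rw [e1, e2, integral_affine_div, integral_affine_div]
    ring
  · nlinarith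
  · intro y hy
    rw [Set.mem_Icc, ← div_le_iff₀' h, ← le_div_iff₀' h] at hy
    have : |y / √3| ≤ 1 := abs_le.2 hy
    linarith

lemma convex_hexRegion (o : Plane) (k : ℝ) : Convex ℝ (hexRegion o k) := by
  have : hexRegion o k = ⋂ i, ({p : Plane | triCoord i p ≤ k + triCoord i o} ∩
      {p : Plane | triCoord i o - k ≤ triCoord i p}) := by
    ext p
    simp only [hexRegion, Set.mem_ofPred_eq, Set.mem_iInter, Set.mem_inter_iff, abs_le]
    refine forall_congr' fun i => ?_
    constructor <;> rintro ⟨h1, h2⟩ <;> constructor <;> linarith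
  rw [this]
  exact convex_iInter fun i => (convex_halfSpace_le (triCoord i).toLinearMap.isLinear _).inter
    (convex_halfSpace_ge (triCoord i).toLinearMap.isLinear _)

lemma Convex.mem_of_triCoord {K : Set Plane} (hK : Convex ℝ K) {o u v p : Plane} (ho : o ∈ K)
    (hu : u ∈ K) (hv : v ∈ K) {s t : ℝ} (hs : 0 ≤ s) (ht : 0 ≤ t) (hst : s + t ≤ 1)
    (hp : ∀ i, triCoord i p - triCoord i o = s * (triCoord i u - triCoord i o) +
      t * (triCoord i v - triCoord i o)) : p ∈ K := by
  have : p = ∑ i : Fin 3, ![s, t, 1 - s - t] i • ![u, v, o] i := by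
    apply ext_triCoord
    intro i
    simp only [Fin.sum_univ_three, map_add, map_smul, Matrix.cons_val_zero, Matrix.cons_val_one,
      Matrix.cons_val, smul_eq_mul]
    linarith [hp i]
  rw [this]
  refine hK.sum_mem ?_ ?_ ?_
  · intro i _
    fin_cases i <;> simp <;> linarith
  · simp [Fin.sum_univ_three]
  · intro i _
    fin_cases i <;> assumption

lemma exists_same_sign {d : Fin 3 → ℝ} :
    ∃ i j l : Fin 3, i ≠ j ∧ i ≠ l ∧ j ≠ l ∧ (0 ≤ d i ∧ 0 ≤ d j ∨ d i ≤ 0 ∧ d j ≤ 0) := by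
  rcases le_total 0 (d 0) with h0 | h0 <;> rcases le_total 0 (d 1) with h1 | h1 <;>
    rcases le_total 0 (d 2) with h2 | h2
  · exact ⟨0, 1, 2, by decide, by decide, by decide, Or.inl ⟨h0, h1⟩⟩
  · exact ⟨0, 1, 2, by decide, by decide, by decide, Or.inl ⟨h0, h1⟩⟩
  · exact ⟨0, 2, 1, by decide, by decide, by decide, Or.inl ⟨h0, h2⟩⟩
  · exact ⟨1, 2, 0, by decide, by decide, by decide, Or.inr ⟨h1, h2⟩⟩
  · exact ⟨1, 2, 0, by decide, by decide, by decide, Or.inl ⟨h1, h2⟩⟩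
  · exact ⟨0, 2, 1, by decide, by decide, by decide, Or.inr ⟨h0, h2⟩⟩
  · exact ⟨0, 1, 2, by decide, by decide, by decide, Or.inr ⟨h0, h1⟩⟩
  · exact ⟨0, 1, 2, by decide, by decide, by decide, Or.inr ⟨h0, h1⟩⟩

/-- The six corners are `o + k (e i - e j)` in triangular coordinates. Among the three deviations of
`p` from `o`, two have the same sign, and they are, up to sign and division by `k`, the coefficients
of `p` in the triangle formed by `o` and two corners. -/
lemma hexRegion_subset {K : Set Plane} (hK : Convex ℝ K) {o : Plane} {k : ℝ} (hk : 0 < k)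
    (h : ∀ i j : Fin 3, i ≠ j → ∀ p, (∀ l, triCoord l p - triCoord l o =
      k * ((if l = i then 1 else 0) - if l = j then 1 else 0)) → p ∈ K) :
    hexRegion o k ⊆ K := by
  have hex : ∀ i j : Fin 3, i ≠ j → ∃ p ∈ K, ∀ l, triCoord l p - triCoord l o =
      k * ((if l = i then 1 else 0) - if l = j then 1 else 0) := by
    intro i j hij
    let c : Fin 3 → ℝ := fun l => triCoord l o +
      k * ((if l = i then 1 else 0) - if l = j then 1 else 0)
    have hc : c 0 + c 1 + c 2 = 0 := by
      have := triCoord_sum o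
      simp only [c]
      fin_cases i <;> fin_cases j <;> simp at hij ⊢ <;> linarith
    have : ∀ l, triCoord l (ofTri (c 0) (c 1)) - triCoord l o =
        k * ((if l = i then 1 else 0) - if l = j then 1 else 0) := fun l => by
      rw [triCoord_ofTri c hc]; simp only [c]; ring
    exact ⟨_, h i j hij _ this, this⟩
  have ho : o ∈ K := by
    obtain ⟨p, hp, hp'⟩ := hex 0 1 (by decide)
    obtain ⟨q, hq, hq'⟩ := hex 1 0 (by decide)
    refine hK.mem_of_triCoord hp hq hp (s := 1 / 2) (t := 0) (by norm_num) le_rfl (by norm_num)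
      fun i => ?_
    linear_combination (-1 / 2) * hp' i - (1 / 2) * hq' i
  intro p hp
  obtain ⟨i, j, l, hij, hil, hjl, hs⟩ := exists_same_sign (d := fun i => triCoord i p - triCoord i o)
  have hsum := triCoord_sum_of_ne p hij hil hjl
  have hsum' := triCoord_sum_of_ne o hij hil hjl
  have hl := abs_le.1 (hp l)
  rcases hs with ⟨h1, h2⟩ | ⟨h1, h2⟩
  · obtain ⟨u, hu, hu'⟩ := hex i l hil
    obtain ⟨v, hv, hv'⟩ := hex j l hjl
    refine hK.mem_of_triCoord ho hu hv (s := (triCoord i p - triCoord i o) / k)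
      (t := (triCoord j p - triCoord j o) / k) (by positivity) (by positivity) ?_ fun m => ?_
    · rw [← add_div, div_le_one hk]; linarith
    · rw [hu', hv']
      have hm : m = i ∨ m = j ∨ m = l := by omega
      rcases hm with rfl | rfl | rfl <;> simp [hij, hil, hjl, hij.symm, hil.symm, hjl.symm] <;>
        field_simp <;> linarith
  · obtain ⟨u, hu, hu'⟩ := hex l i hil.symm
    obtain ⟨v, hv, hv'⟩ := hex l j hjl.symm
    refine hK.mem_of_triCoord ho hu hv (s := -(triCoord i p - triCoord i o) / k)
      (t := -(triCoord j p - triCoord j o) / k) (div_nonneg (by linarith) hk.le)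
      (div_nonneg (by linarith) hk.le) ?_ fun m => ?_
    · rw [← add_div, div_le_one hk]; linarith
    · rw [hu', hv']
      have hm : m = i ∨ m = j ∨ m = l := by omega
      rcases hm with rfl | rfl | rfl <;> simp [hij, hil, hjl, hij.symm, hil.symm, hjl.symm] <;>
        field_simp <;> linarith

/-- The vertices of the regular hexagon with centre `o` and first vertex `o + w`. -/
noncomputable def hexVert (o w : Plane) : Fin 6 → Plane :=
  ![o + w, o - ofTri (triCoord 1 w) (triCoord 2 w), o + ofTri (triCoord 2 w) (triCoord 0 w),
    o - w, o + ofTri (triCoord 1 w) (triCoord 2 w), o - ofTri (triCoord 2 w) (triCoord 0 w)]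

/-- Rotation by a third of a turn is a cyclic shift of triangular coordinates; together with
negation this yields all the corners of a regular hexagon. -/
lemma triCoord_rotate (w : Plane) (i c : Fin 3) :
    triCoord i (ofTri (triCoord c w) (triCoord (1 + c) w)) = triCoord (i + c) w := by
  have h := triCoord_ofTri (fun i => triCoord (i + c) w) ?_ i
  · simpa only [zero_add] using h
  have := triCoord_sum w
  fin_cases c <;> simp <;> linarith

lemma mem_range_hexVert_iff (o w p : Plane) : p ∈ Set.range (hexVert o w) ↔
    ∃ c : Fin 3, (∀ i, triCoord i p - triCoord i o = triCoord (i + c) w) ∨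
      (∀ i, triCoord i p - triCoord i o = -triCoord (i + c) w) := by
  have h1 := fun i => triCoord_rotate w i 1
  have h2 := fun i => triCoord_rotate w i 2
  rw [show (1 : Fin 3) + 1 = 2 from rfl] at h1
  rw [show (1 : Fin 3) + 2 = 0 from rfl] at h2
  constructor
  · rintro ⟨j, rfl⟩
    fin_cases j
    · exact ⟨0, Or.inl fun i => by simp [hexVert]⟩
    · exact ⟨1, Or.inr fun i => by simp [hexVert, h1]⟩
    · exact ⟨2, Or.inl fun i => by simp [hexVert, h2]⟩
    · exact ⟨0, Or.inr fun i => by simp [hexVert]⟩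
    · exact ⟨1, Or.inl fun i => by simp [hexVert, h1]⟩
    · exact ⟨2, Or.inr fun i => by simp [hexVert, h2]⟩
  · rintro ⟨c, h | h⟩ <;> fin_cases c
    · exact ⟨0, ext_triCoord fun i => by have := h i; simp [hexVert] at this ⊢; linarith⟩
    · exact ⟨4, ext_triCoord fun i => by have := h i; simp [hexVert, h1] at this ⊢; linarith⟩
    · exact ⟨2, ext_triCoord fun i => by have := h i; simp [hexVert, h2] at this ⊢; linarith⟩
    · exact ⟨3, ext_triCoord fun i => by have := h i; simp [hexVert] at this ⊢; linarith⟩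
    · exact ⟨1, ext_triCoord fun i => by have := h i; simp [hexVert, h1] at this ⊢; linarith⟩
    · exact ⟨5, ext_triCoord fun i => by have := h i; simp [hexVert, h2] at this ⊢; linarith⟩

lemma convexHull_hexVert_of_aligned {o w : Plane} {m : ℝ} (hm : m ≠ 0) {i j : Fin 3}
    (hij : i ≠ j) (hw : ∀ l, triCoord l w = m * ((if l = i then 1 else 0) -
      if l = j then 1 else 0)) :
    convexHull ℝ (Set.range (hexVert o w)) = hexRegion o |m| := by
  apply Set.Subset.antisymm
  · refine convexHull_min ?_ (convex_hexRegion _ _)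
    intro p hp l
    have hle : ∀ l, |triCoord l w| ≤ |m| := by
      intro l
      rw [hw, abs_mul]
      refine mul_le_of_le_one_right (abs_nonneg _) ?_
      split_ifs <;> norm_num
    obtain ⟨c, h | h⟩ := (mem_range_hexVert_iff _ _ _).1 hp
    · rw [h]; exact hle _
    · rw [h, abs_neg]; exact hle _
  · refine hexRegion_subset (convex_convexHull _ _) (abs_pos.2 hm) fun a b hab p hp => ?_
    refine subset_convexHull ℝ _ ((mem_range_hexVert_iff _ _ _).2 ?_)
    -- The cyclic shifts of `±(e i - e j)` exhaust the six vectors `e a - e b`; `e` is the sign of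
    -- `m`. The check is done over the integers, where it is decidable.
    have key : ∀ i j a b : Fin 3, i ≠ j → a ≠ b → ∀ e : Bool, ∃ c : Fin 3,
        (∀ l, (if e then 1 else -1 : ℤ) * ((if l = a then 1 else 0) - if l = b then 1 else 0) =
          (if l + c = i then 1 else 0) - if l + c = j then 1 else 0) ∨
        (∀ l, (if e then 1 else -1 : ℤ) * ((if l = a then 1 else 0) - if l = b then 1 else 0) =
          -((if l + c = i then 1 else 0) - if l + c = j then 1 else 0)) := by decide
    have hint : ∀ (l a b : Fin 3), ((if l = a then 1 else 0) - if l = b then 1 else 0 : ℝ) =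
        (((if l = a then 1 else 0) - if l = b then 1 else 0 : ℤ) : ℝ) := by
      intro l a b; push_cast; rfl
    rcases abs_choice m with hm' | hm'
    · obtain ⟨c, h | h⟩ := key i j a b hij hab true
      · refine ⟨c, Or.inl fun l => ?_⟩
        rw [hp, hw, hm', hint, hint, ← h]; simp
      · refine ⟨c, Or.inr fun l => ?_⟩
        have := h l
        rw [hp, hw, hm', hint, hint, ← mul_neg, ← Int.cast_neg, ← h]; simp
    · obtain ⟨c, h | h⟩ := key i j a b hij hab false
      · refine ⟨c, Or.inl fun l => ?_⟩
        rw [hp, hw, hm', hint, hint, ← h]; simp; ring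
      · refine ⟨c, Or.inr fun l => ?_⟩
        rw [hp, hw, hm', hint, hint, ← mul_neg, ← Int.cast_neg, ← h]; simp; ring

/-! ### Regular polygons -/

lemma cos_sin_hexagon (θ : ℝ) (j : Fin 6) :
    Real.cos (θ + 2 * Real.pi * (j : ℝ) / (6 : ℕ)) =
        ![Real.cos θ, Real.cos θ / 2 - √3 / 2 * Real.sin θ,
          -Real.cos θ / 2 - √3 / 2 * Real.sin θ, -Real.cos θ,
          -Real.cos θ / 2 + √3 / 2 * Real.sin θ, Real.cos θ / 2 + √3 / 2 * Real.sin θ] j ∧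
      Real.sin (θ + 2 * Real.pi * (j : ℝ) / (6 : ℕ)) =
        ![Real.sin θ, Real.sin θ / 2 + √3 / 2 * Real.cos θ,
          -Real.sin θ / 2 + √3 / 2 * Real.cos θ, -Real.sin θ,
          -Real.sin θ / 2 - √3 / 2 * Real.cos θ, Real.sin θ / 2 - √3 / 2 * Real.cos θ] j := by
  have e0 : θ + 2 * Real.pi * ((0 : ℕ) : ℝ) / (6 : ℕ) = θ := by push_cast; ring
  have e1 : θ + 2 * Real.pi * ((1 : ℕ) : ℝ) / (6 : ℕ) = θ + Real.pi / 3 := by push_cast; ring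
  have e2 : θ + 2 * Real.pi * ((2 : ℕ) : ℝ) / (6 : ℕ) = (θ - Real.pi / 3) + Real.pi := by
    push_cast; ring
  have e3 : θ + 2 * Real.pi * ((3 : ℕ) : ℝ) / (6 : ℕ) = θ + Real.pi := by push_cast; ring
  have e4 : θ + 2 * Real.pi * ((4 : ℕ) : ℝ) / (6 : ℕ) = (θ + Real.pi / 3) + Real.pi := by
    push_cast; ring
  have e5 : θ + 2 * Real.pi * ((5 : ℕ) : ℝ) / (6 : ℕ) = (θ - Real.pi / 3) + 2 * Real.pi := by
    push_cast; ring
  fin_cases j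
  · exact ⟨congrArg Real.cos e0, congrArg Real.sin e0⟩
  · refine ⟨(congrArg Real.cos e1).trans ?_, (congrArg Real.sin e1).trans ?_⟩ <;>
      simp [Real.cos_add, Real.sin_add] <;> ring
  · refine ⟨(congrArg Real.cos e2).trans ?_, (congrArg Real.sin e2).trans ?_⟩ <;>
      simp [Real.cos_add_pi, Real.sin_add_pi, Real.cos_sub, Real.sin_sub] <;> ring
  · refine ⟨(congrArg Real.cos e3).trans ?_, (congrArg Real.sin e3).trans ?_⟩ <;> simp
  · refine ⟨(congrArg Real.cos e4).trans ?_, (congrArg Real.sin e4).trans ?_⟩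
    · rw [Real.cos_add_pi, Real.cos_add]; simp; ring
    · rw [Real.sin_add_pi, Real.sin_add]; simp; ring
  · refine ⟨(congrArg Real.cos e5).trans ?_, (congrArg Real.sin e5).trans ?_⟩ <;>
      simp [Real.cos_sub, Real.sin_sub] <;> ring

lemma regularHexagon_eq_hexVert (o : Plane) (R θ : ℝ) :
    (fun j : Fin 6 => o + R • (!₂[Real.cos (θ + 2 * Real.pi * (j : ℝ) / (6 : ℕ)),
      Real.sin (θ + 2 * Real.pi * (j : ℝ) / (6 : ℕ))] : Plane)) =
    hexVert o (R • !₂[Real.cos θ, Real.sin θ]) := by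
  have hsq : √3 ^ 2 = (3 : ℝ) := Real.sq_sqrt (by norm_num)
  have a1 : ∀ w : Plane, ofTri (triCoord 1 w) (triCoord 2 w) =
      !₂[-w 0 / 2 + √3 / 2 * w 1, -(√3 / 2) * w 0 - w 1 / 2] := by
    intro w
    ext i
    fin_cases i
    · simp [ofTri_apply_zero, triCoord_apply_one, triCoord_apply_two]
      field_simp
      linear_combination (-w 1) * hsq
    · simp [ofTri_apply_one, triCoord_apply_two]
      field_simp
  have a2 : ∀ w : Plane, ofTri (triCoord 2 w) (triCoord 0 w) =
      !₂[-w 0 / 2 - √3 / 2 * w 1, √3 / 2 * w 0 - w 1 / 2] := by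
    intro w
    ext i
    fin_cases i
    · simp [ofTri_apply_zero, triCoord_apply_zero, triCoord_apply_two]
      field_simp
      linear_combination (w 1) * hsq
    · simp [ofTri_apply_one, triCoord_apply_zero]
      field_simp
  funext j
  rw [(cos_sin_hexagon θ j).1, (cos_sin_hexagon θ j).2]
  unfold hexVert
  rw [a1, a2]
  fin_cases j <;> ext i <;> fin_cases i <;> simp <;> ring

lemma IsRegularPolygon.exists_hexVert {s : ℝ} {S : Set Plane} (h : IsRegularPolygon 6 s S) :
    ∃ o w : Plane, w ≠ 0 ∧ S = convexHull ℝ (Set.range (hexVert o w)) := by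
  obtain ⟨o, R, θ, hR, -, rfl⟩ := h
  refine ⟨o, R • !₂[Real.cos θ, Real.sin θ], ?_, ?_⟩
  · intro h0
    have c0 : (R • (!₂[Real.cos θ, Real.sin θ] : Plane)) 0 = 0 := by rw [h0]; rfl
    have c1 : (R • (!₂[Real.cos θ, Real.sin θ] : Plane)) 1 = 0 := by rw [h0]; rfl
    simp [hR.ne'] at c0 c1
    have := Real.cos_sq_add_sin_sq θ
    rw [c0, c1] at this
    norm_num at this
  · rw [← regularHexagon_eq_hexVert]

lemma isRegularPolygon_hexRegion (o : Plane) {k : ℝ} (hk : 0 < k) :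
    IsRegularPolygon 6 k (hexRegion o k) := by
  refine ⟨o, k, 0, hk, ?_, ?_⟩
  · have : Real.pi / (6 : ℕ) = Real.pi / 6 := by norm_num
    rw [this, Real.sin_pi_div_six]; ring
  · rw [regularHexagon_eq_hexVert, convexHull_hexVert_of_aligned (m := k) hk.ne' (i := 0) (j := 2)
      (by decide), abs_of_pos hk]
    intro l
    fin_cases l
    · simp [triCoord_apply_zero]
    · simp [triCoord_apply_one]
    · simp [triCoord_apply_two]

lemma isRegularPolygon_triangle {τ : Fin 3 → ℝ} {l : ℝ} (hl : l = 2 ∨ l = -2)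
    (hτ : τ 0 + τ 1 + τ 2 = -l) :
    IsRegularPolygon 3 2 {p | ∀ i, 0 ≤ (triCoord i p - τ i) / l} := by
  have h3 := sqrt_three_pos
  have hsq : √3 ^ 2 = (3 : ℝ) := Real.sq_sqrt (by norm_num)
  let c : Fin 3 → ℝ := fun i => τ i + l / 3
  have hc : c 0 + c 1 + c 2 = 0 := by simp only [c]; linarith
  -- These are the unit vectors at angles `-π/6`, `π/2` and `7π/6`. They point from the centre to
  -- the vertices if `l = 2`; for `l = -2` they are turned by `π`.
  let d : Fin 3 → Plane := ![!₂[√3 / 2, -1 / 2], !₂[0, 1], !₂[-(√3 / 2), -1 / 2]]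
  have hd : ∀ i j, triCoord j (d i) = √3 * ((if i = j then 1 else 0) - 1 / 3) := by
    intro i j
    fin_cases i <;> fin_cases j <;>
      simp [d, triCoord_apply_zero, triCoord_apply_one, triCoord_apply_two] <;> field_simp <;>
      rw [hsq] <;> norm_num
  have hl0 : l ≠ 0 := by rcases hl with rfl | rfl <;> norm_num
  have side : (2 : ℝ) = 2 * (2 / √3) * Real.sin (Real.pi / (3 : ℕ)) := by
    have : Real.pi / (3 : ℕ) = Real.pi / 3 := by norm_num
    rw [this, Real.sin_pi_div_three]; field_simp
  obtain ⟨θ, hθ⟩ : ∃ θ : ℝ, ∀ j : Fin 3, (2 / √3) •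
      (!₂[Real.cos (θ + 2 * Real.pi * (j : ℝ) / (3 : ℕ)),
        Real.sin (θ + 2 * Real.pi * (j : ℝ) / (3 : ℕ))] : Plane) = (l / √3) • d j := by
    have hbase : ∀ j : Fin 3, (!₂[Real.cos (-(Real.pi / 6) + 2 * Real.pi * (j : ℝ) / (3 : ℕ)),
        Real.sin (-(Real.pi / 6) + 2 * Real.pi * (j : ℝ) / (3 : ℕ))] : Plane) = d j := by
      have e1 : -(Real.pi / 6) + 2 * Real.pi * ((1 : ℕ) : ℝ) / (3 : ℕ) = Real.pi / 2 := by
        push_cast; ring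
      have e2 : -(Real.pi / 6) + 2 * Real.pi * ((2 : ℕ) : ℝ) / (3 : ℕ) =
          Real.pi / 6 + Real.pi := by
        push_cast; ring
      intro j
      fin_cases j
      · simp [d]; norm_num
      · change !₂[Real.cos (-(Real.pi / 6) + 2 * Real.pi * ((1 : ℕ) : ℝ) / (3 : ℕ)),
          Real.sin (-(Real.pi / 6) + 2 * Real.pi * ((1 : ℕ) : ℝ) / (3 : ℕ))] = d 1
        rw [e1]
        simp [d]
      · change !₂[Real.cos (-(Real.pi / 6) + 2 * Real.pi * ((2 : ℕ) : ℝ) / (3 : ℕ)),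
          Real.sin (-(Real.pi / 6) + 2 * Real.pi * ((2 : ℕ) : ℝ) / (3 : ℕ))] = d 2
        rw [e2, Real.cos_add_pi, Real.sin_add_pi]
        simp [d]; norm_num
    rcases hl with rfl | rfl
    · exact ⟨_, fun j => by rw [hbase]⟩
    · refine ⟨-(Real.pi / 6) + Real.pi, fun j => ?_⟩
      have : -(Real.pi / 6) + Real.pi + 2 * Real.pi * (j : ℝ) / (3 : ℕ) =
          (-(Real.pi / 6) + 2 * Real.pi * (j : ℝ) / (3 : ℕ)) + Real.pi := by ring
      rw [this, Real.cos_add_pi, Real.sin_add_pi, ← hbase]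
      ext i
      fin_cases i <;> simp <;> ring
  refine ⟨ofTri (c 0) (c 1), 2 / √3, θ, by positivity, side, ?_⟩
  symm
  refine convexHull_triangle hl0 hτ fun i j => ?_
  rw [hθ, map_add, map_smul, hd, triCoord_ofTri c hc, smul_eq_mul]
  simp only [c]
  split_ifs <;> field_simp <;> ring

/-! ### Hexagons that are unions of cells -/

lemma exists_weights_of_mem_convexHull {v : Fin 3 → Plane} {p : Plane}
    (hp : p ∈ convexHull ℝ (Set.range v)) :
    ∃ c : Fin 3 → ℝ, (∀ i, 0 ≤ c i) ∧ ∑ i, c i = 1 ∧ p = ∑ i, c i • v i := by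
  have hsub : convexHull ℝ (Set.range v) ⊆
      (Fintype.linearCombination ℝ v) '' stdSimplex ℝ (Fin 3) := by
    refine convexHull_min ?_ ((convex_stdSimplex ℝ (Fin 3)).linear_image _)
    rintro _ ⟨i, rfl⟩
    exact ⟨Pi.single i 1, single_mem_stdSimplex ℝ i, by simp⟩
  obtain ⟨c, hc, rfl⟩ := hsub hp
  exact ⟨c, hc.1, hc.2, rfl⟩

lemma norm_sub_of_mem_range_hexVert {o w p : Plane} (hp : p ∈ Set.range (hexVert o w)) :
    ‖p - o‖ = ‖w‖ := by
  rw [← sq_eq_sq₀ (norm_nonneg _) (norm_nonneg _), norm_sq_eq_triCoord, norm_sq_eq_triCoord]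
  simp only [map_sub]
  obtain ⟨c, h | h⟩ := (mem_range_hexVert_iff _ _ _).1 hp <;> rw [h, h, h] <;> fin_cases c <;>
    simp <;> ring

section Tessellation

variable {X : Finset Cell} {o w : Plane}

/-- A corner lies on the circumscribed circle, so it is an extreme point of the disc. It remains
extreme in the cell that contains it, hence is a vertex of that cell. -/
lemma exists_vert_of_mem_range_hexVert (hw : w ≠ 0)
    (h : (⋃ t ∈ X, convexHull ℝ (Set.range t.vert)) = convexHull ℝ (Set.range (hexVert o w)))
    {p : Plane} (hp : p ∈ Set.range (hexVert o w)) : ∃ (t : Cell) (i : Fin 3), t.vert i = p := by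
  have hball : convexHull ℝ (Set.range (hexVert o w)) ⊆ Metric.closedBall o ‖w‖ := by
    refine convexHull_min (fun q hq => ?_) (convex_closedBall _ _)
    rw [Metric.mem_closedBall, dist_eq_norm, norm_sub_of_mem_range_hexVert hq]
  have hp' := subset_convexHull ℝ _ hp
  rw [← h] at hp' hball
  obtain ⟨t, ht, hpt⟩ := Set.mem_iUnion₂.1 hp'
  have hext : p ∈ (Metric.closedBall o ‖w‖).extremePoints ℝ := by
    refine StrictConvexSpace.sphere_subset_extremePoints_closedBall o (norm_ne_zero_iff.2 hw) ?_
    rw [Metric.mem_sphere, dist_eq_norm, norm_sub_of_mem_range_hexVert hp]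
  have := inter_extremePoints_subset_extremePoints_of_subset
    ((Set.subset_iUnion₂ (s := fun t (_ : t ∈ X) => convexHull ℝ (Set.range t.vert)) t ht).trans
      hball) ⟨hpt, hext⟩
  obtain ⟨i, hi⟩ := extremePoints_convexHull_subset this
  exact ⟨t, i, hi⟩

lemma exists_int_triCoord (hw : w ≠ 0)
    (h : (⋃ t ∈ X, convexHull ℝ (Set.range t.vert)) = convexHull ℝ (Set.range (hexVert o w))) :
    (∀ i, ∃ n : ℤ, triCoord i w = n) ∧ (∀ i, ∃ n : ℤ, triCoord i o = n) ∧
      ∀ p ∈ Set.range (hexVert o w), ∀ i, ∃ n : ℤ, triCoord i p = n := by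
  have hv : ∀ p ∈ Set.range (hexVert o w), ∀ i, ∃ n : ℤ, triCoord i p = n := by
    intro p hp i
    obtain ⟨t, j, rfl⟩ := exists_vert_of_mem_range_hexVert hw h hp
    exact ⟨_, t.triCoord_vert j i⟩
  have h1 := fun i => triCoord_rotate w i 1
  have h2 := fun i => triCoord_rotate w i 2
  rw [show (1 : Fin 3) + 1 = 2 from rfl] at h1
  rw [show (1 : Fin 3) + 2 = 0 from rfl] at h2
  have hwi : ∀ i, ∃ n : ℤ, triCoord i w = n := by
    intro i
    -- Corner `1` minus corner `2` is `w`, because the three cyclic shifts of `w` add up to zero.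
    obtain ⟨m, hm⟩ := hv _ ⟨1, rfl⟩ i
    obtain ⟨n, hn⟩ := hv _ ⟨2, rfl⟩ i
    refine ⟨m - n, ?_⟩
    have hs := triCoord_sum_of_ne w (i := i) (j := i + 1) (k := i + 2) (by clear * -; revert i; decide)
      (by clear * -; revert i; decide) (by clear * -; revert i; decide)
    simp [hexVert, h1, h2] at hm hn
    push_cast
    linarith
  refine ⟨hwi, fun i => ?_, hv⟩
  obtain ⟨m, hm⟩ := hv _ ⟨0, rfl⟩ i
  obtain ⟨n, hn⟩ := hwi i
  refine ⟨m - n, ?_⟩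
  simp [hexVert] at hm
  push_cast
  linarith

/-- The linear functional which is constant on the edge of the hexagon between its vertices
number 1 and 2. -/
noncomputable def edgeFunctional (w : Plane) : Plane →L[ℝ] ℝ :=
  ∑ i, (triCoord (i + 2) w - triCoord (i + 1) w) • triCoord i

lemma edgeFunctional_apply (w p : Plane) : edgeFunctional w p =
    (triCoord 2 w - triCoord 1 w) * triCoord 0 p + (triCoord 0 w - triCoord 2 w) * triCoord 1 p +
      (triCoord 1 w - triCoord 0 w) * triCoord 2 p := by
  simp [edgeFunctional, Fin.sum_univ_three]

/-- It is enough to compare corners, and there each difference is a nonnegative multiple of the sum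
of squared differences of the coordinates of `w`. -/
lemma edgeFunctional_le {p : Plane} (hp : p ∈ convexHull ℝ (Set.range (hexVert o w))) :
    edgeFunctional w p ≤ edgeFunctional w (hexVert o w 1) := by
  refine convexHull_min (t := {p | edgeFunctional w p ≤ edgeFunctional w (hexVert o w 1)}) ?_
    (convex_halfSpace_le (edgeFunctional w).toLinearMap.isLinear _) hp
  intro q hq
  have h1 := fun i => triCoord_rotate w i 1
  rw [show (1 : Fin 3) + 1 = 2 from rfl] at h1
  have hv : ∀ i, triCoord i (hexVert o w 1) = triCoord i o - triCoord (i + 1) w := by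
    intro i; simp [hexVert, h1]
  rw [Set.mem_ofPred_eq, edgeFunctional_apply, edgeFunctional_apply, hv, hv, hv]
  obtain ⟨c, h⟩ := (mem_range_hexVert_iff _ _ _).1 hq
  have hq' : ∃ e : ℝ, (e = 1 ∨ e = -1) ∧
      ∀ i, triCoord i q = triCoord i o + e * triCoord (i + c) w := by
    rcases h with h | h
    · exact ⟨1, Or.inl rfl, fun i => by linarith [h i]⟩
    · exact ⟨-1, Or.inr rfl, fun i => by linarith [h i]⟩
  obtain ⟨e, he, hq'⟩ := hq'
  rw [hq', hq', hq']
  generalize triCoord 0 o = a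
  generalize triCoord 1 o = b
  generalize triCoord 2 o = d
  have hsq : ∀ x y z : ℝ, 0 ≤ (x - y) ^ 2 + (y - z) ^ 2 + (z - x) ^ 2 := by
    intros; positivity
  have := hsq (triCoord 0 w) (triCoord 1 w) (triCoord 2 w)
  rcases he with rfl | rfl <;> fin_cases c <;> simp <;> nlinarith

/-- A non-lattice point of an edge lies in some cell. As `edgeFunctional` is maximal there, every
vertex of the cell with nonzero weight is on the edge line, and there are at least two of these. So
a side of the cell is parallel to `w`, and some triangular coordinate vanishes along it. -/
lemma exists_triCoord_eq_zero (hw : w ≠ 0)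
    (h : (⋃ t ∈ X, convexHull ℝ (Set.range t.vert)) = convexHull ℝ (Set.range (hexVert o w))) :
    ∃ i, triCoord i w = 0 := by
  obtain ⟨-, -, hv⟩ := exists_int_triCoord hw h
  have h1 := fun i => triCoord_rotate w i 1
  have h2 := fun i => triCoord_rotate w i 2
  rw [show (1 : Fin 3) + 1 = 2 from rfl] at h1
  rw [show (1 : Fin 3) + 2 = 0 from rfl] at h2
  have hs := triCoord_sum w
  -- `N` exceeds every coordinate of `w` in absolute value, so moving `1/N` of the way from the
  -- integral corner `1` leaves some coordinate strictly between integers.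
  set N : ℝ := 2 + |triCoord 0 w| + |triCoord 1 w| + |triCoord 2 w| with hN
  have hNpos : 0 < N := by positivity
  have hN1 : 1 ≤ N := by
    have := abs_nonneg (triCoord 0 w)
    have := abs_nonneg (triCoord 1 w)
    have := abs_nonneg (triCoord 2 w)
    linarith
  set p : Plane := (1 - 1 / N) • hexVert o w 1 + (1 / N) • hexVert o w 2 with hp
  have hpS : p ∈ convexHull ℝ (Set.range (hexVert o w)) := by
    refine convex_convexHull ℝ _ (subset_convexHull ℝ _ (Set.mem_range_self 1))
      (subset_convexHull ℝ _ (Set.mem_range_self 2))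
      ?_ (by positivity) (by ring)
    rw [sub_nonneg, div_le_one hNpos]
    exact hN1
  have hpc : ∀ i, triCoord i p = triCoord i (hexVert o w 1) - triCoord i w / N := by
    intro i
    rw [hp, map_add, map_smul, map_smul, smul_eq_mul, smul_eq_mul]
    have : triCoord i (hexVert o w 2) = triCoord i (hexVert o w 1) - triCoord i w := by
      have hs := triCoord_sum_of_ne w (i := i) (j := i + 1) (k := i + 2)
        (by clear * -; revert i; decide) (by clear * -; revert i; decide)
        (by clear * -; revert i; decide)
      simp [hexVert, h1, h2]
      linarith
    rw [this]; ring
  have hpE : edgeFunctional w p = edgeFunctional w (hexVert o w 1) := by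
    rw [edgeFunctional_apply, edgeFunctional_apply, hpc, hpc, hpc]
    ring
  have hnonint : ∃ i, ∀ n : ℤ, triCoord i p ≠ n := by
    obtain ⟨i, hi⟩ : ∃ i, triCoord i w ≠ 0 := by
      by_contra! hcon
      exact hw (ext_triCoord fun i => by rw [hcon, map_zero])
    refine ⟨i, fun n hn => ?_⟩
    obtain ⟨m, hm⟩ := hv _ ⟨1, rfl⟩ i
    have hlt : |triCoord i w / N| < 1 := by
      rw [abs_div, abs_of_pos hNpos, div_lt_one hNpos, hN]
      have := abs_nonneg (triCoord 0 w)
      have := abs_nonneg (triCoord 1 w)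
      have := abs_nonneg (triCoord 2 w)
      fin_cases i <;> simp <;> linarith
    have heq : triCoord i w / N = ((m - n : ℤ) : ℝ) := by
      have := hpc i
      rw [hn, hm] at this
      push_cast
      linarith
    rw [heq, ← Int.cast_abs] at hlt
    have h0 : |m - n| < 1 := by exact_mod_cast hlt
    rw [Int.abs_lt_one_iff.1 h0, Int.cast_zero, div_eq_zero_iff] at heq
    rcases heq with h | h
    · exact hi h
    · exact hNpos.ne' h
  have hpU := hpS
  rw [← h] at hpU
  obtain ⟨t, ht, hpt⟩ := Set.mem_iUnion₂.1 hpU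
  obtain ⟨c, hc0, hc1, hpsum⟩ := exists_weights_of_mem_convexHull hpt
  have htS : ∀ i, t.vert i ∈ convexHull ℝ (Set.range (hexVert o w)) := by
    intro i
    rw [← h]
    exact Set.mem_iUnion₂.2 ⟨t, ht, subset_convexHull ℝ _ ⟨i, rfl⟩⟩
  have hface : ∀ i, c i ≠ 0 → edgeFunctional w (t.vert i) = edgeFunctional w (hexVert o w 1) := by
    have hle : ∀ i ∈ Finset.univ, c i * edgeFunctional w (t.vert i) ≤
        c i * edgeFunctional w (hexVert o w 1) :=
      fun i _ => mul_le_mul_of_nonneg_left (edgeFunctional_le (htS i)) (hc0 i)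
    have hsum : ∑ i, c i * edgeFunctional w (t.vert i) =
        ∑ i, c i * edgeFunctional w (hexVert o w 1) := by
      rw [← Finset.sum_mul, hc1, one_mul, ← hpE, hpsum, map_sum]
      simp
    intro i hi
    exact mul_left_cancel₀ hi ((Finset.sum_eq_sum_iff_of_le hle).1 hsum i (Finset.mem_univ i))
  obtain ⟨i, j, hij, hi, hj⟩ : ∃ i j, i ≠ j ∧ c i ≠ 0 ∧ c j ≠ 0 := by
    by_contra! hcon
    obtain ⟨l, hl⟩ := hnonint
    obtain ⟨i, hi⟩ : ∃ i, c i ≠ 0 := by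
      by_contra! h0
      simp [h0] at hc1
    have hz : ∀ j, j ≠ i → c j = 0 := fun j hj => hcon i j hj.symm hi
    have hci : c i = 1 := by
      rw [← hc1]; exact (Finset.sum_eq_single i (fun j _ hj => hz j hj) (by simp)).symm
    have hpi : p = t.vert i := by
      rw [hpsum, Finset.sum_eq_single i (fun j _ hj => by rw [hz j hj, zero_smul]) (by simp), hci,
        one_smul]
    exact hl _ (by rw [hpi, Cell.triCoord_vert])
  -- The functional vanishes on `e i - e j`; since the coordinates of `w` have zero sum, its value
  -- there is `±3` times the third coordinate of `w`.
  have hEq := (hface i hi).trans (hface j hj).symm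
  rw [edgeFunctional_apply, edgeFunctional_apply] at hEq
  simp only [Cell.triCoord_vert, Cell.vertCoord] at hEq
  have ht : (t.sum : ℝ) = -1 ∨ (t.sum : ℝ) = -2 := by
    rcases t.sum_cases with h | h <;> rw [h] <;> simp
  by_contra! hcon
  have n0 := hcon 0
  have n1 := hcon 1
  have n2 := hcon 2
  clear * - hEq ht hs n0 n1 n2 hij
  have e2 : triCoord 2 w = -triCoord 0 w - triCoord 1 w := by linarith
  rw [e2] at n2 hEq
  push_cast at hEq
  rcases ht with ht | ht <;> rw [ht] at hEq <;> fin_cases i <;> fin_cases j <;>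
    simp at hij hEq <;>
    first
      | (apply n0; linarith)
      | (apply n1; linarith)
      | (apply n2; linarith)

/-- A regular hexagon which is a union of cells is a lattice hexagon. -/
theorem exists_eq_hexRegion_of_iUnion (hw : w ≠ 0)
    (h : (⋃ t ∈ X, convexHull ℝ (Set.range t.vert)) = convexHull ℝ (Set.range (hexVert o w))) :
    ∃ (c : Fin 3 → ℤ) (k : ℕ), c 0 + c 1 + c 2 = 0 ∧ 1 ≤ k ∧ (∀ i, triCoord i o = c i) ∧
      convexHull ℝ (Set.range (hexVert o w)) = hexRegion o k := by
  obtain ⟨hwi, hoi, -⟩ := exists_int_triCoord hw h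
  choose c hc using hoi
  obtain ⟨l, hl⟩ := exists_triCoord_eq_zero hw h
  obtain ⟨i, j, hij, hil, hjl⟩ : ∃ i j, i ≠ j ∧ i ≠ l ∧ j ≠ l := by
    clear * -; revert l; decide
  have hs := triCoord_sum_of_ne w hij hil hjl
  obtain ⟨m, hm⟩ := hwi i
  have hwc : ∀ a, triCoord a w = (m : ℝ) * ((if a = i then 1 else 0) - if a = j then 1 else 0) := by
    intro a
    have ha : a = i ∨ a = j ∨ a = l := by omega
    rcases ha with rfl | rfl | rfl
    · simp [hij, hm]
    · simp [hij.symm]; linarith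
    · simp [hil.symm, hjl.symm, hl]
  have hm0 : m ≠ 0 := by
    rintro rfl
    exact hw (ext_triCoord fun a => by rw [hwc, map_zero]; simp)
  refine ⟨c, m.natAbs, ?_, Int.natAbs_pos.2 hm0, hc, ?_⟩
  · have := triCoord_sum o
    rw [hc, hc, hc] at this
    exact_mod_cast this
  · rw [convexHull_hexVert_of_aligned (Int.cast_ne_zero.2 hm0) hij hwc, Nat.cast_natAbs,
      Int.cast_abs]

end Tessellation

/-! ### Hexagons and their cells -/

namespace Cell

lemma interior_dualCell_subset (t : Cell) :
    interior (dualCell (equivVertices t)) ⊆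
      {p | ∀ i, (t.1 i : ℝ) < triCoord i p ∧ triCoord i p < t.1 i + 1} := by
  intro p hp i
  have hsub : dualCell (equivVertices t) ⊆ triCoord i ⁻¹' Set.Icc (t.1 i : ℝ) (t.1 i + 1) :=
    fun q hq => (mem_dualCell_iff t q).1 hq i
  have hopen : IsOpenMap (triCoord i) := by
    refine (triCoord i).isOpenMap_of_ne_zero fun h0 => ?_
    have : triCoord i (ofTri 1 1) = 0 := by rw [h0]; rfl
    fin_cases i
    · exact one_ne_zero ((triCoord_ofTri_zero 1 1).symm.trans this)
    · exact one_ne_zero ((triCoord_ofTri_one 1 1).symm.trans this)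
    · have h2 := (triCoord_ofTri_two 1 1).symm.trans this
      norm_num at h2
  have := interior_mono hsub hp
  rw [← hopen.preimage_interior_eq_interior_preimage (triCoord i).continuous, interior_Icc] at this
  exact this

lemma eq_of_mem_Ioo {t t' : Cell} {p : Plane}
    (h : ∀ i, (t.1 i : ℝ) < triCoord i p ∧ triCoord i p < t.1 i + 1)
    (h' : ∀ i, (t'.1 i : ℝ) ≤ triCoord i p ∧ triCoord i p ≤ t'.1 i + 1) : t = t' := by
  apply Subtype.ext
  funext i
  have a1 : (t.1 i : ℝ) < (t'.1 i + 1 : ℤ) := by push_cast; linarith [(h i).1, (h' i).2]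
  have a2 : (t'.1 i : ℝ) < (t.1 i + 1 : ℤ) := by push_cast; linarith [(h i).2, (h' i).1]
  have a1' := Int.cast_lt.1 a1
  have a2' := Int.cast_lt.1 a2
  omega

/-- Disjointness of interiors is automatic: an interior point of a cell has its coordinates strictly
between consecutive integers, which determine the address. -/
lemma cellsTessellate_map_iff (X : Finset Cell) (S : Set Plane) :
    CellsTessellate (X.map equivVertices.toEmbedding) S ↔
      (⋃ t ∈ X, convexHull ℝ (Set.range t.vert)) = S := by
  have hU : (⋃ x ∈ X.map equivVertices.toEmbedding, dualCell x) =
      ⋃ t ∈ X, convexHull ℝ (Set.range t.vert) := by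
    simp only [← dualCell_equivVertices]
    ext p
    simp only [Set.mem_iUnion, Finset.mem_map_equiv, exists_prop]
    refine (equivVertices.symm.exists_congr fun x => ?_)
    rw [Equiv.apply_symm_apply]
  unfold CellsTessellate
  rw [hU]
  refine and_iff_left ?_
  intro x _ y _ hxy
  obtain ⟨t, rfl⟩ := equivVertices.surjective x
  obtain ⟨t', rfl⟩ := equivVertices.surjective y
  refine Set.disjoint_left.2 fun p hp hp' => hxy ?_
  rw [eq_of_mem_Ioo (interior_dualCell_subset t hp)
    fun i => (mem_dualCell_iff t' p).1 (interior_subset hp') i]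

lemma mem_convexHull_vert_iff (t : Cell) (p : Plane) : p ∈ convexHull ℝ (Set.range t.vert) ↔
    ∀ i, (t.1 i : ℝ) ≤ triCoord i p ∧ triCoord i p ≤ t.1 i + 1 := by
  rw [convexHull_vert]; rfl

/-- A point of a lattice hexagon lies in a cell of the hexagon. -/
lemma exists_cell_of_mem_hexRegion {c : Fin 3 → ℤ} {k : ℕ} (hc : c 0 + c 1 + c 2 = 0)
    (hk : 1 ≤ k) {p : Plane} (hp : ∀ i, |triCoord i p - c i| ≤ k) :
    ∃ t : Cell, (∀ i, c i - k ≤ t.1 i ∧ t.1 i < c i + k) ∧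
      ∀ i, (t.1 i : ℝ) ≤ triCoord i p ∧ triCoord i p ≤ t.1 i + 1 := by
  have hsum := triCoord_sum p
  -- The cap matters only on the closed side `ξ i = c i + k`, where the floor would leave the
  -- hexagon.
  let f : Fin 3 → ℤ := fun i => min ⌊triCoord i p⌋ (c i + k - 1)
  have hf : ∀ i, (c i - k ≤ f i ∧ f i < c i + k) ∧
      ((f i : ℝ) ≤ triCoord i p ∧ triCoord i p ≤ f i + 1) ∧
      (triCoord i p = f i + 1 → triCoord i p = c i + k) := by
    intro i
    obtain ⟨h1, h2⟩ := abs_le.1 (hp i)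
    have hfl : c i - k ≤ ⌊triCoord i p⌋ := by
      rw [Int.le_floor]; push_cast; linarith
    have l1 := Int.floor_le (triCoord i p)
    have l2 := Int.lt_floor_add_one (triCoord i p)
    rcases le_total ⌊triCoord i p⌋ (c i + k - 1) with h | h
    · have e : f i = ⌊triCoord i p⌋ := min_eq_left h
      rw [e]
      exact ⟨⟨hfl, by omega⟩, ⟨l1, l2.le⟩, fun h => absurd h l2.ne⟩
    · have e : f i = c i + k - 1 := min_eq_right h
      have h' : ((c i + k - 1 : ℤ) : ℝ) ≤ ⌊triCoord i p⌋ := Int.cast_le.2 h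
      rw [e]
      push_cast at h' ⊢
      refine ⟨⟨by omega, by omega⟩, ⟨by linarith, by linarith⟩, fun h => by linarith⟩
  have hck : ((c 0 + c 1 + c 2 : ℤ) : ℝ) = 0 := by rw [hc]; simp
  push_cast at hck
  have hk' : (1 : ℝ) ≤ k := by exact_mod_cast hk
  obtain ⟨b0, u0, v0⟩ := hf 0
  obtain ⟨b1, u1, v1⟩ := hf 1
  obtain ⟨b2, u2, v2⟩ := hf 2
  -- Sum `-3` would put all three coordinates at their upper ends `c i + k`, against zero sum.
  have hlow : -3 < f 0 + f 1 + f 2 := by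
    have h3 : (-3 : ℝ) ≤ ((f 0 + f 1 + f 2 : ℤ) : ℝ) := by push_cast; linarith
    refine lt_of_le_of_ne (by exact_mod_cast h3) fun h => ?_
    have h' : ((f 0 + f 1 + f 2 : ℤ) : ℝ) = -3 := by rw [← h]; simp
    push_cast at h'
    linarith [v0 (by linarith), v1 (by linarith), v2 (by linarith)]
  have hhigh : f 0 + f 1 + f 2 ≤ 0 := by
    have h3 : ((f 0 + f 1 + f 2 : ℤ) : ℝ) ≤ 0 := by push_cast; linarith
    exact_mod_cast h3
  by_cases h0 : f 0 + f 1 + f 2 = 0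
  · have h' : ((f 0 + f 1 + f 2 : ℤ) : ℝ) = 0 := by rw [h0]; simp
    push_cast at h'
    have e : ∀ i, triCoord i p = f i := by
      intro i
      fin_cases i <;> simp <;> linarith
    -- For sum `0` the point is a lattice point; lowering a coordinate that is not yet minimal gives
    -- a cell of the hexagon having it as a vertex.
    obtain ⟨i, hi⟩ : ∃ i, c i - k < f i := by
      by_contra! hcon
      have := hcon 0
      have := hcon 1
      have := hcon 2
      omega
    refine ⟨⟨fun j => f j - if j = i then 1 else 0, Or.inl ?_⟩, fun j => ?_, fun j => ?_⟩
    · fin_cases i <;> simp <;> omega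
    · have := (hf j).1
      dsimp only
      split_ifs with h
      · subst h; omega
      · omega
    · rw [e]
      dsimp only
      split_ifs <;> push_cast <;> constructor <;> linarith
  · exact ⟨⟨f, by omega⟩, fun i => (hf i).1, fun i => (hf i).2.1⟩

lemma IsHexagon.iUnion_eq {X : Finset Cell} {c : Fin 3 → ℤ} {k : ℕ} (h : IsHexagon X c k) :
    (⋃ t ∈ X, convexHull ℝ (Set.range t.vert)) = hexRegion (ofTri (c 0) (c 1)) k := by
  have ho : ∀ i, triCoord i (ofTri (c 0) (c 1)) = c i :=
    triCoord_ofTri (fun i => (c i : ℝ)) (by exact_mod_cast h.1)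
  ext p
  simp only [Set.mem_iUnion₂, mem_convexHull_vert_iff, hexRegion, Set.mem_ofPred_eq, ho]
  constructor
  · rintro ⟨t, ht, hp⟩ i
    obtain ⟨h1, h2⟩ := (h.2.2 t).1 ht i
    have h1' : ((c i - k : ℤ) : ℝ) ≤ t.1 i := Int.cast_le.2 h1
    have h2' : ((t.1 i + 1 : ℤ) : ℝ) ≤ ((c i + k : ℤ) : ℝ) := Int.cast_le.2 h2
    push_cast at h1' h2'
    rw [abs_le]
    constructor <;> linarith [(hp i).1, (hp i).2]
  · intro hp
    obtain ⟨t, ht, hpt⟩ := exists_cell_of_mem_hexRegion h.1 h.2.1 hp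
    exact ⟨t, (h.2.2 t).2 ht, hpt⟩

lemma isHexagon_of_iUnion_eq {X : Finset Cell} {o : Plane} {c : Fin 3 → ℤ} {k : ℕ}
    (hc : c 0 + c 1 + c 2 = 0) (hk : 1 ≤ k) (ho : ∀ i, triCoord i o = c i)
    (h : (⋃ t ∈ X, convexHull ℝ (Set.range t.vert)) = hexRegion o k) : IsHexagon X c k := by
  refine ⟨hc, hk, fun t => ⟨fun ht i => ?_, fun ht => ?_⟩⟩
  · have hv : ∀ j, t.vert j ∈ hexRegion o k := by
      intro j
      rw [← h]
      exact Set.mem_iUnion₂.2 ⟨t, ht, subset_convexHull ℝ _ ⟨j, rfl⟩⟩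
    have hb : ∀ j, c i - k ≤ t.vertCoord j i ∧ t.vertCoord j i ≤ c i + k := by
      intro j
      have := hv j i
      rw [triCoord_vert, ho, abs_le] at this
      have h1 : ((c i - k : ℤ) : ℝ) ≤ (t.vertCoord j i : ℤ) := by push_cast; linarith [this.1]
      have h2 : (t.vertCoord j i : ℝ) ≤ ((c i + k : ℤ) : ℝ) := by push_cast; linarith [this.2]
      exact ⟨Int.cast_le.1 h1, Int.cast_le.1 h2⟩
    -- In the `i`-th coordinate, vertices `i` and `i + 1` take the values `t i` and `t i + 1` in
    -- some order.
    have b1 := hb i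
    have b2 := hb (i + 1)
    have hne : i + 1 ≠ i := by clear * -; revert i; decide
    simp only [vertCoord, hne, if_true, if_false] at b1 b2
    have := t.sum_cases
    omega
  · have hmem : t.center ∈ hexRegion o k := by
      intro i
      obtain ⟨h1, h2⟩ := ht i
      obtain ⟨a1, a2⟩ := t.center_mem_Ioo i
      have h1' : ((c i - k : ℤ) : ℝ) ≤ t.1 i := Int.cast_le.2 h1
      have h2' : ((t.1 i + 1 : ℤ) : ℝ) ≤ ((c i + k : ℤ) : ℝ) := Int.cast_le.2 h2
      push_cast at h1' h2'
      rw [ho, abs_le]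
      constructor <;> linarith
    rw [← h] at hmem
    obtain ⟨t', ht', hct⟩ := Set.mem_iUnion₂.1 hmem
    rw [eq_of_mem_Ioo t.center_mem_Ioo ((mem_convexHull_vert_iff t' _).1 hct)]
    exact ht'

lemma isHexagon_of_tessellates_regular {X : Finset Cell} {s : ℝ} {S : Set Plane}
    (hS : IsRegularPolygon 6 s S) (h : (⋃ t ∈ X, convexHull ℝ (Set.range t.vert)) = S) :
    ∃ c k, IsHexagon X c k := by
  obtain ⟨o, w, hw, rfl⟩ := hS.exists_hexVert
  obtain ⟨c, k, hc, hk, ho, he⟩ := exists_eq_hexRegion_of_iUnion hw h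
  exact ⟨c, k, isHexagon_of_iUnion_eq hc hk ho (h.trans he)⟩

/-! ### The optimal constant and the region `H` -/

lemma inner_center_nb_sub (t : Cell) (i : Fin 3) (p : Plane) :
    inner ℝ p ((nb i t).center - t.center) = -(3 + 2 * t.sum) * triCoord i p / 2 := by
  have hc : ∀ j, triCoord j ((nb i t).center - t.center) =
      (3 + 2 * t.sum) * (1 / 3 - if j = i then 1 else 0) := by
    intro j
    rw [map_sub, triCoord_center, triCoord_center, sum_nb]
    simp only [nb]
    push_cast
    split_ifs <;> ring
  have hp := triCoord_sum p
  rw [inner_eq_triCoord, hc, hc, hc]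
  fin_cases i <;> simp <;> linear_combination (3 + 2 * (t.sum : ℝ)) / 3 * hp

lemma neighborVectors_eq (t : Cell) : neighborVectors unitWeight (equivVertices t) =
    Set.range fun i => (nb i t).center - t.center := by
  ext v
  constructor
  · rintro ⟨y, hy, rfl⟩
    obtain ⟨t', rfl⟩ := equivVertices.surjective y
    obtain ⟨i, rfl⟩ := (unitWeight_ne_zero_iff _ _).1 hy
    refine ⟨i, ?_⟩
    rw [unitWeight_nb, one_pow, one_smul, coe_equivVertices, coe_equivVertices]
  · rintro ⟨i, rfl⟩
    refine ⟨equivVertices (nb i t), (unitWeight_ne_zero_iff _ _).2 ⟨i, rfl⟩, ?_⟩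
    rw [unitWeight_nb, one_pow, one_smul, coe_equivVertices, coe_equivVertices]

lemma finsum_neighborVectors (t : Cell) (c : Plane → ℝ) :
    ∑ᶠ v ∈ neighborVectors unitWeight (equivVertices t), c v =
      ∑ i, c ((nb i t).center - t.center) := by
  have hinj : Function.Injective fun i => (nb i t).center - t.center := by
    intro i j h
    exact nb_inj (center_injective (sub_left_injective h))
  rw [neighborVectors_eq, finsum_mem_range hinj, finsum_eq_sum_of_fintype]

lemma halfspaceIntersection_neighborVectors (t : Cell) (c : Plane → ℝ) :
    halfspaceIntersection (neighborVectors unitWeight (equivVertices t)) c =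
      {p | ∀ i, 0 ≤ (triCoord i p -
        -2 * (3 + 2 * t.sum) * c ((nb i t).center - t.center)) / (2 * (3 + 2 * t.sum))} := by
  ext p
  rw [neighborVectors_eq]
  simp only [halfspaceIntersection, Set.forall_mem_range, Set.mem_ofPred_eq, inner_center_nb_sub]
  refine forall_congr' fun i => ?_
  rcases t.sum_cases with h | h <;> rw [h] <;> norm_num <;> constructor <;> intro h' <;> linarith

/-- The constraint on `c` enters only here: it fixes the signed size of the triangle at `±2`, so `c`
affects only its position. -/
lemma triangle_data (t : Cell) {c : Plane → ℝ}
    (hc : ∑ᶠ v ∈ neighborVectors unitWeight (equivVertices t), c v = 1) :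
    (2 * (3 + 2 * t.sum : ℝ) = 2 ∨ 2 * (3 + 2 * t.sum : ℝ) = -2) ∧
      -2 * (3 + 2 * t.sum : ℝ) * c ((nb 0 t).center - t.center) +
        -2 * (3 + 2 * t.sum : ℝ) * c ((nb 1 t).center - t.center) +
        -2 * (3 + 2 * t.sum : ℝ) * c ((nb 2 t).center - t.center) = -(2 * (3 + 2 * t.sum)) := by
  rw [finsum_neighborVectors, Fin.sum_univ_three] at hc
  refine ⟨?_, by linear_combination -2 * (3 + 2 * (t.sum : ℝ)) * hc⟩
  rcases t.sum_cases with h | h <;> rw [h] <;> norm_num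

end Cell

/-! ### The region `H`, the equality cases and the final assembly -/

open Cell

lemma wulffRegion_unitWeight : wulffRegion unitWeight unitWeight = hexRegion 0 2 := by
  ext p
  simp only [wulffRegion, hexRegion, Set.mem_ofPred_eq, map_zero, sub_zero]
  constructor
  · intro h i
    have key : ∀ t : Cell, -(3 + 2 * t.sum) * triCoord i p / 2 ≤ 1 := by
      intro t
      have := h (equivVertices t) (equivVertices (nb i t))
        ((unitWeight_ne_zero_iff _ _).2 ⟨i, rfl⟩)
      rwa [unitWeight_nb, one_mul, real_inner_comm, coe_equivVertices, coe_equivVertices,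
        inner_center_nb_sub] at this
    -- One cell of each orientation: their neighbour vectors are opposite and give the two halves of
    -- the absolute value bound.
    have h1 := key ⟨![0, 0, -1], by simp⟩
    have h2 := key ⟨![0, 0, -2], by simp⟩
    simp [Cell.sum] at h1 h2
    rw [abs_le]
    constructor <;> linarith
  · intro h x y hxy
    obtain ⟨t, rfl⟩ := equivVertices.surjective x
    obtain ⟨t', rfl⟩ := equivVertices.surjective y
    obtain ⟨i, rfl⟩ := (unitWeight_ne_zero_iff _ _).1 hxy
    rw [unitWeight_nb, one_mul, real_inner_comm, coe_equivVertices, coe_equivVertices,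
      inner_center_nb_sub]
    obtain ⟨h1, h2⟩ := abs_le.1 (h i)
    rcases t.sum_cases with hs | hs <;> rw [hs] <;> push_cast <;> linarith

lemma image_hexRegion (t : Plane) {r : ℝ} (hr : 0 < r) :
    (fun p => t + r • p) '' hexRegion 0 2 = hexRegion t (2 * r) := by
  ext p
  constructor
  · rintro ⟨q, hq, rfl⟩ i
    have := hq i
    rw [map_zero, sub_zero] at this
    rw [map_add, map_smul, add_sub_cancel_left, smul_eq_mul, abs_mul, abs_of_pos hr]
    nlinarith
  · intro hp
    refine ⟨r⁻¹ • (p - t), fun i => ?_, ?_⟩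
    · have := hp i
      rw [map_zero, sub_zero, map_smul, map_sub, smul_eq_mul, abs_mul, abs_of_pos (inv_pos.2 hr),
        inv_mul_le_iff₀ hr]
      linarith
    · simp [smul_smul, hr.ne']

/-- The sets of equality are the hexagons. -/
lemma six_mul_card_eq_iff {X : Finset Cell} (hX : X.Nonempty) :
    (6 * X.card = perimeter X ^ 2 ↔ ∃ (r : ℝ) (t : Plane), 0 < r ∧
      CellsTessellate (X.map equivVertices.toEmbedding)
        ((fun p => t + r • p) '' wulffRegion unitWeight unitWeight)) ∧
    (6 * X.card = perimeter X ^ 2 ↔ ∃ k : ℕ, 1 ≤ k ∧ X.card = 6 * k ^ 2 ∧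
      ∃ (s : ℝ) (S : Set Plane), IsRegularPolygon 6 s S ∧
        CellsTessellate (X.map equivVertices.toEmbedding) S) := by
  simp only [cellsTessellate_map_iff, wulffRegion_unitWeight]
  have hcase : ∀ c k, IsHexagon X c k → 6 * X.card = perimeter X ^ 2 := fun c k h => h.card_eq.2
  refine ⟨⟨fun h => ?_, ?_⟩, ⟨fun h => ?_, ?_⟩⟩
  · obtain ⟨c, k, hk⟩ := exists_isHexagon_of_eq hX h
    have hkpos : (0 : ℝ) < k := by exact_mod_cast hk.2.1
    refine ⟨k / 2, ofTri (c 0) (c 1), by positivity, ?_⟩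
    rw [image_hexRegion _ (by positivity), hk.iUnion_eq, mul_div_cancel₀ _ two_ne_zero]
  · rintro ⟨r, t, hr, h⟩
    rw [image_hexRegion _ hr] at h
    obtain ⟨c, k, hk⟩ := isHexagon_of_tessellates_regular
      (isRegularPolygon_hexRegion t (by positivity : 0 < 2 * r)) h
    exact hcase c k hk
  · obtain ⟨c, k, hk⟩ := exists_isHexagon_of_eq hX h
    have hkpos : (0 : ℝ) < k := by exact_mod_cast hk.2.1
    exact ⟨k, hk.2.1, hk.card_eq.1, k, _, isRegularPolygon_hexRegion _ hkpos, hk.iUnion_eq⟩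
  · rintro ⟨-, -, -, s, S, hS, h⟩
    obtain ⟨c, k, hk⟩ := isHexagon_of_tessellates_regular hS h
    exact hcase c k hk

lemma exists_map_equivVertices (X : Finset honeycombVertices) :
    ∃ Y : Finset Cell, X = Y.map equivVertices.toEmbedding := by
  refine ⟨X.map equivVertices.symm.toEmbedding, ?_⟩
  ext x
  simp

theorem mainTheorem6 :
    -- the optimal constant of every vertex is `√3`, and the optimal shape is an
    -- equilateral triangle of side length `2`
    (∀ x : honeycombVertices,
      IsOptimalConstant (neighborVectors unitWeight x) (ENNReal.ofReal (√3)) ∧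
      ∀ c : Plane → ℝ, ∑ᶠ v ∈ neighborVectors unitWeight x, c v = 1 →
        volume (halfspaceIntersection (neighborVectors unitWeight x) c) = ENNReal.ofReal (√3) →
        IsRegularPolygon 3 2 (halfspaceIntersection (neighborVectors unitWeight x) c)) ∧
    -- the region `H` is a regular hexagon of side length `2` and area `6√3`
    (IsRegularPolygon 6 2 (wulffRegion unitWeight unitWeight) ∧
      volume (wulffRegion unitWeight unitWeight) = ENNReal.ofReal (6 * √3)) ∧
    -- the edge-isoperimetric inequality
    (∀ X : Finset honeycombVertices,
      6 * X.card ≤ (orientedBoundary unitWeight X).ncard ^ 2) ∧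
    -- the equality cases
    (∀ X : Finset honeycombVertices, X.Nonempty →
      ((6 * X.card = (orientedBoundary unitWeight X).ncard ^ 2 ↔
          ∃ (r : ℝ) (t : Plane), 0 < r ∧
            CellsTessellate X ((fun p => t + r • p) '' wulffRegion unitWeight unitWeight)) ∧
        (6 * X.card = (orientedBoundary unitWeight X).ncard ^ 2 ↔
          ∃ k : ℕ, 1 ≤ k ∧ X.card = 6 * k ^ 2 ∧
            ∃ (s : ℝ) (S : Set Plane), IsRegularPolygon 6 s S ∧ CellsTessellate X S))) ∧
    -- sharpness
    (∀ k : ℕ, 1 ≤ k → ∃ X : Finset honeycombVertices, X.card = 6 * k ^ 2 ∧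
      6 * X.card = (orientedBoundary unitWeight X).ncard ^ 2) := by
  refine ⟨fun x => ?_, ⟨?_, ?_⟩, fun X => ?_, fun X hX => ?_, fun k hk => ?_⟩
  · obtain ⟨t, rfl⟩ := equivVertices.surjective x
    have hvol : ∀ c : Plane → ℝ,
        ∑ᶠ v ∈ neighborVectors unitWeight (equivVertices t), c v = 1 →
        volume (halfspaceIntersection (neighborVectors unitWeight (equivVertices t)) c) =
          ENNReal.ofReal (√3) := by
      intro c hc
      obtain ⟨hl, hτ⟩ := triangle_data t hc
      rw [halfspaceIntersection_neighborVectors]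
      exact volume_triangle hl hτ
    -- All admissible `c` give the same area, so any choice attains the maximum.
    refine ⟨⟨⟨fun _ => 1 / 3, ?_, ?_⟩, ?_⟩, fun c hc _ => ?_⟩
    · rw [finsum_neighborVectors, Fin.sum_univ_three]; norm_num
    · refine (hvol _ ?_).symm
      rw [finsum_neighborVectors, Fin.sum_univ_three]; norm_num
    · rintro a ⟨c, hc, rfl⟩
      exact (hvol c hc).le
    · obtain ⟨hl, hτ⟩ := triangle_data t hc
      rw [halfspaceIntersection_neighborVectors]
      exact isRegularPolygon_triangle hl hτ
  · rw [wulffRegion_unitWeight]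
    exact isRegularPolygon_hexRegion 0 two_pos
  · rw [wulffRegion_unitWeight]
    exact volume_hexRegion_two
  · obtain ⟨Y, rfl⟩ := exists_map_equivVertices X
    rw [ncard_orientedBoundary, Finset.card_map]
    exact six_mul_card_le Y
  · obtain ⟨Y, rfl⟩ := exists_map_equivVertices X
    rw [ncard_orientedBoundary, Finset.card_map]
    exact six_mul_card_eq_iff (Finset.map_nonempty.1 hX)
  · obtain ⟨X, hX⟩ := exists_isHexagon (o := fun _ => 0) (by simp) hk
    refine ⟨X.map equivVertices.toEmbedding, ?_, ?_⟩
    · rw [Finset.card_map]; exact hX.card_eq.1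
    · rw [ncard_orientedBoundary, Finset.card_map]; exact hX.card_eq.2
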